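/- Let $a>0$, $\gamma\ge 1$, $\rho_s>0$, $\mu>0$, $\kappa>0$ and $T>0$, put $b=a\gamma\rho_s^{\gamma-2}$, and consider on $(0,T)\times(0,\pi)$ the linearized compressible Navier-Stokes system with Maxwell's law $$\partial_t\rho+\rho_s\partial_x u=f_1,\qquad \partial_t u+b\,\partial_x\rho-\tfrac1{\rho_s}\partial_x S=f_2,\qquad \partial_t S+\tfrac1\kappa S-\tfrac\mu\kappa\partial_x u=f_3,$$ with $u(t,0)=u(t,\pi)=0$ and $(\rho,u,S)(0)=(\rho_0,u_0,S_0)$. All functions are real-valued, or all are complex-valued. Let $L^2_m(0,\pi)=\{f\in L^2(0,\pi):\int_0^\pi f\,dx=0\}$. Write $z=(\rho,u,S)$, $F=(f_1,f_2,f_3)$, and let $A(\rho,u,S)=\big(-\rho_s u',\,(-b\rho+\tfrac1{\rho_s}S)',\,\tfrac\mu\kappa u'-\tfrac1\kappa S\big)$ with domain $D(A)=\{(\rho,u,S)\in (L^2(0,\pi))^3: u\in H^1_0(0,\pi),\ -b\rho+\tfrac1{\rho_s}S\in H^1(0,\pi)\}$. A solution is a function $z\in C([0,T];(L^2(0,\pi))^3)$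 such that, for every $t\in[0,T]$, $\int_0^t z\,ds\in D(A)$ and $z(t)=z_0+A\int_0^t z\,ds+\int_0^t F\,ds$. (i) (Density control.) For every $(\rho_0,u_0,S_0)\in L^2(0,\pi)\times L^2(0,\pi)\times L^2_m(0,\pi)$ there is a control $f_1\in L^2(0,T;L^2(0,\pi))$, acting on the whole of $(0,\pi)$, such that the system with $f_2=f_3=0$ has exactly one solution $(\rho,u,S)$, and this solution belongs to $C([0,T];L^2(0,\pi)\times L^2(0,\pi)\times L^2_m(0,\pi))$ and satisfies $\rho(T,\cdot)=u(T,\cdot)=S(T,\cdot)=0$. (ii) (Stress control.) For every $(\rho_0,u_0,S_0)\in L^2_m(0,\pi)\times L^2(0,\pi)\times L^2(0,\pi)$ there is a control $f_3\in L^2(0,T;L^2(0,\pi))$, acting on the whole of $(0,\pi)$, such that the system with $f_1=f_2=0$ has exactly one solution $(\rho,u,S)$, and this solution belongs to $C([0,T];L^2_m(0,\pi)\times L^2(0,\pi)\times L^2(0,\pi))$ and satisfies $\rho(T,\cdot)=u(T,\cdot)=S(T,\cdot)=0$. -/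

import Mathlib

open MeasureTheory Set
open scoped ContDiff

namespace MaxwellCNS

/-- `L²(0,π)` with values in `𝕜` (`ℝ` or `ℂ`). -/
abbrev L2 (𝕜 : Type*) [RCLike 𝕜] : Type _ :=
  Lp 𝕜 2 (volume.restrict (Ioo (0 : ℝ) Real.pi))

/-- The space `L²_m(0,π)` of the square integrable functions with zero mean. -/
def L2m (𝕜 : Type*) [RCLike 𝕜] : Set (L2 𝕜) :=
  {f | ∫ x in Ioo (0 : ℝ) Real.pi, f x = 0}

/-- The state space `(L²(0,π))³`, with elements `(ρ, u, S)`. -/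
abbrev State (𝕜 : Type*) [RCLike 𝕜] : Type _ := L2 𝕜 × L2 𝕜 × L2 𝕜

/-- `v ∈ L²(0,π)` is the weak derivative of `u ∈ L²(0,π)`; in particular `u ∈ H¹(0,π)`. -/
def HasWeakDeriv {𝕜 : Type*} [RCLike 𝕜] (u v : L2 𝕜) : Prop :=
  ∀ φ : ℝ → ℝ, ContDiff ℝ ∞ φ → HasCompactSupport φ → tsupport φ ⊆ Ioo 0 Real.pi →
    ∫ x in Ioo (0 : ℝ) Real.pi, deriv φ x • u x = - ∫ x in Ioo (0 : ℝ) Real.pi, φ x • v x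

/-- `u` has a representative that is continuous on `[0,π]` and vanishes at `0` and at `π`
(every element of `H¹(0,π)` has exactly one representative that is continuous on `[0,π]`). -/
def VanishesAtEnds {𝕜 : Type*} [RCLike 𝕜] (u : L2 𝕜) : Prop :=
  ∃ g : ℝ → 𝕜, ContinuousOn g (Icc 0 Real.pi) ∧
    (∀ᵐ x ∂(volume.restrict (Ioo (0 : ℝ) Real.pi)), u x = g x) ∧ g 0 = 0 ∧ g Real.pi = 0

/-- The graph of the unbounded operator
`A (ρ, u, S) = (-ρₛ u', (-b ρ + S / ρₛ)', (μ/κ) u' - S / κ)`, `b = a γ ρₛ^(γ-2)`, with domain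
`D(A) = {(ρ, u, S) ∈ (L²)³ : u ∈ H¹₀(0,π), -b ρ + S / ρₛ ∈ H¹(0,π)}`:
`IsOpA a γ ρₛ μ κ z w` says that `z ∈ D(A)` and `A z = w`. -/
def IsOpA {𝕜 : Type*} [RCLike 𝕜] (a γ ρs μ κ : ℝ) (z w : State 𝕜) : Prop :=
  ∃ du dq : L2 𝕜,
    HasWeakDeriv z.2.1 du ∧ VanishesAtEnds z.2.1 ∧
    HasWeakDeriv (-(a * γ * ρs ^ (γ - 2)) • z.1 + (1 / ρs) • z.2.2) dq ∧
    w = (-ρs • du, dq, (μ / κ) • du - (1 / κ) • z.2.2)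

/-- `z ∈ C([0,T]; (L²)³)` is the (mild) solution of `z' = A z + F`, `z(0) = z₀`, on `[0,T]`:
for every `t ∈ [0,T]`, `∫₀ᵗ z ∈ D(A)` and `z(t) = z₀ + A ∫₀ᵗ z + ∫₀ᵗ F`. -/
def IsSolution {𝕜 : Type*} [RCLike 𝕜] (a γ ρs μ κ T : ℝ) (z₀ : State 𝕜) (F : ℝ → State 𝕜)
    (z : ℝ → State 𝕜) : Prop :=
  ContinuousOn z (Icc 0 T) ∧
  ∀ t ∈ Icc 0 T,
    IsOpA a γ ρs μ κ (∫ s in (0 : ℝ)..t, z s) (z t - z₀ - ∫ s in (0 : ℝ)..t, F s)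

/-- The function `f` of time, given on `(0,T)`, belongs to `L²(0,T; L²(0,π))`. -/
def IsControl {𝕜 : Type*} [RCLike 𝕜] (T : ℝ) (f : ℝ → L2 𝕜) : Prop :=
  MemLp f 2 (volume.restrict (Ioo 0 T))

end MaxwellCNS

/-! Expand `ρ` and `S` in cosines and `u` in sines. The system splits into 3×3 systems, one per
frequency n, and both control problems take the same form p' = -lam p + α n u, u' = n (β r + G p),
r' = -ν r + E n u + f, where r is the controlled one of `ρ`, `S` and p is the other one. At n = 0
the control cannot reach p; the zero mean hypothesis says that this mode of p vanishes.

For n ≥ 1, p is a flat output: solving the equations in turn expresses u, r and f through p, p',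
p'', p'''. Steering a single mode is then easy; the difficulty is a bound uniform in n. Take p = θ
g, with θ a time cutoff equal to 1 near 0 and to 0 near T, and g a constant plus an oscillation of
frequency w n, where w² = -(αG + βE) > 0. The terms of f that grow like n carry the undifferentiated
θ, and they cancel because g''' = -w² n² g'. So p, u, r, f are bounded by a constant times the data
of the mode (`exists_mode_control`); square summability of the data passes to the coefficients,
which are therefore those of continuous curves in L² (`exists_null_control`).

The dictionary between coefficients and the operator is `hasWeakDeriv_of_cosC`,
`vanishesAtEnds_of_cosC`, `hasWeakDeriv_of_sinC` in one direction and `HasWeakDeriv.cosC_eq`,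
`HasWeakDeriv.sinC_eq` in the other. The latter gives uniqueness: each coefficient triple of the
difference of two solutions solves a linear ODE with zero initial value. -/

namespace MaxwellCNS

/-! ### Sine and cosine bases of L²(0,π), and continuous curves given by coefficients. -/

section TrigonometricBases

variable {𝕜 : Type*} [RCLike 𝕜]

/-- A continuous real function defines a (bounded, square integrable) element of `L²(0,π)`. -/
theorem memLp_of_continuous (φ : C(ℝ, ℝ)) :
    MemLp (fun x => ((φ x : ℝ) : 𝕜)) 2 (volume.restrict (Ioo (0 : ℝ) Real.pi)) := by
  obtain ⟨C, hC⟩ := (isCompact_Icc (a := (0 : ℝ)) (b := Real.pi)).exists_bound_of_continuousOn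
    φ.continuous.continuousOn
  refine MemLp.of_bound (RCLike.continuous_ofReal.comp φ.continuous).aestronglyMeasurable C ?_
  filter_upwards [ae_restrict_mem measurableSet_Ioo] with x hx
  simpa using hC x (Ioo_subset_Icc_self hx)

/-- The class in `L²(0,π)` of a continuous real function. -/
noncomputable def ofReal (φ : C(ℝ, ℝ)) : L2 𝕜 := (memLp_of_continuous (𝕜 := 𝕜) φ).toLp

theorem coeFn_ofReal (φ : C(ℝ, ℝ)) :
    ∀ᵐ x ∂(volume.restrict (Ioo (0 : ℝ) Real.pi)), (ofReal φ : L2 𝕜) x = ((φ x : ℝ) : 𝕜) :=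
  MemLp.coeFn_toLp _

theorem inner_ofReal (φ : C(ℝ, ℝ)) (f : L2 𝕜) :
    inner 𝕜 (ofReal φ) f = ∫ x in Ioo (0 : ℝ) Real.pi, φ x • f x := by
  rw [L2.inner_def]
  refine integral_congr_ae ?_
  filter_upwards [coeFn_ofReal (𝕜 := 𝕜) φ] with x hx
  rw [hx, RCLike.inner_apply, RCLike.conj_ofReal, RCLike.real_smul_eq_coe_mul, mul_comm]

theorem inner_ofReal_ofReal (φ ψ : C(ℝ, ℝ)) :
    inner 𝕜 (ofReal φ) (ofReal ψ : L2 𝕜) = ((∫ x in (0 : ℝ)..Real.pi, φ x * ψ x : ℝ) : 𝕜) := by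
  rw [inner_ofReal, intervalIntegral.integral_of_le Real.pi_pos.le, ← integral_Ioc_eq_integral_Ioo,
    ← integral_ofReal, integral_Ioc_eq_integral_Ioo, integral_Ioc_eq_integral_Ioo]
  refine integral_congr_ae ?_
  filter_upwards [coeFn_ofReal (𝕜 := 𝕜) ψ] with x hx
  rw [hx, RCLike.real_smul_eq_coe_mul]
  push_cast; rfl

theorem integrable_L2 (f : L2 𝕜) : Integrable f (volume.restrict (Ioo (0 : ℝ) Real.pi)) :=
  (Lp.memLp f).integrable (by norm_num)

theorem integrable_smul_L2 {φ : ℝ → ℝ} (hφ : Continuous φ) (f : L2 𝕜) :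
    Integrable (fun x => φ x • f x) (volume.restrict (Ioo (0 : ℝ) Real.pi)) := by
  obtain ⟨C, hC⟩ := (isCompact_Icc (a := (0 : ℝ)) (b := Real.pi)).exists_bound_of_continuousOn
    hφ.continuousOn
  refine (integrable_L2 f).bdd_smul C hφ.aestronglyMeasurable ?_
  filter_upwards [ae_restrict_mem measurableSet_Ioo] with x hx
  exact hC x (Ioo_subset_Icc_self hx)

/-- An integrable function on `(0,π)` that is orthogonal to all powers of `cos` vanishes. -/
theorem ae_eq_zero_of_integral_cos_pow {f : ℝ → 𝕜}
    (hf : Integrable f (volume.restrict (Ioo (0 : ℝ) Real.pi)))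
    (h : ∀ k : ℕ, ∫ x in Ioo (0 : ℝ) Real.pi, (Real.cos x ^ k) • f x = 0) :
    f =ᵐ[volume.restrict (Ioo (0 : ℝ) Real.pi)] 0 := by
  have hint : ∀ {φ : ℝ → ℝ}, Continuous φ →
      Integrable (fun x => φ x • f x) (volume.restrict (Ioo (0 : ℝ) Real.pi)) := by
    intro φ hφ
    obtain ⟨C, hC⟩ := (isCompact_Icc (a := (0 : ℝ)) (b := Real.pi)).exists_bound_of_continuousOn
      hφ.continuousOn
    refine hf.bdd_smul C hφ.aestronglyMeasurable ?_
    filter_upwards [ae_restrict_mem measurableSet_Ioo] with x hx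
    exact hC x (Ioo_subset_Icc_self hx)
  have hpi : ∀ p : Polynomial ℝ, Integrable (fun x => (p.eval (Real.cos x)) • f x)
      (volume.restrict (Ioo (0 : ℝ) Real.pi)) :=
    fun p => hint (p.continuous.comp Real.continuous_cos)
  have hpoly : ∀ p : Polynomial ℝ,
      ∫ x in Ioo (0 : ℝ) Real.pi, (p.eval (Real.cos x)) • f x = 0 := by
    intro p
    induction p using Polynomial.induction_on' with
    | add p q hp hq =>
      simp only [Polynomial.eval_add, add_smul]
      rw [integral_add (hpi p) (hpi q), hp, hq, add_zero]
    | monomial n c =>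
      simp only [Polynomial.eval_monomial, mul_smul]
      rw [integral_smul, h n, smul_zero]
  refine ae_eq_zero_of_integral_contDiff_smul_eq_zero hf.locallyIntegrable fun g hg _ => ?_
  rw [← norm_le_zero_iff]
  refine le_of_forall_pos_le_add fun ε hε => ?_
  set M := ∫ x in Ioo (0 : ℝ) Real.pi, ‖f x‖
  have hM : 0 ≤ M := integral_nonneg fun x => norm_nonneg _
  -- Weierstrass for g ∘ arccos on [-1,1]: on (0,π), g is uniformly close to a polynomial in cos.
  -- The +1 guards against M = 0.
  obtain ⟨p, hp⟩ := exists_polynomial_near_of_continuousOn (-1) 1 (fun y => g (Real.arccos y))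
    (hg.continuous.comp Real.continuous_arccos).continuousOn (ε / (M + 1)) (by positivity)
  have hsub : ∫ x in Ioo (0 : ℝ) Real.pi, g x • f x =
      ∫ x in Ioo (0 : ℝ) Real.pi, (g x - p.eval (Real.cos x)) • f x := by
    simp only [sub_smul]
    rw [integral_sub (hint hg.continuous) (hpi p), hpoly, sub_zero]
  rw [hsub]
  calc ‖∫ x in Ioo (0 : ℝ) Real.pi, (g x - p.eval (Real.cos x)) • f x‖
      ≤ ∫ x in Ioo (0 : ℝ) Real.pi, ε / (M + 1) * ‖f x‖ := by
        refine norm_integral_le_of_norm_le (hf.norm.const_mul _) ?_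
        filter_upwards [ae_restrict_mem measurableSet_Ioo] with x hx
        rw [norm_smul]
        gcongr
        have := hp (Real.cos x) ⟨Real.neg_one_le_cos x, Real.cos_le_one x⟩
        rw [Real.arccos_cos hx.1.le hx.2.le, abs_sub_comm] at this
        exact this.le
    _ = ε / (M + 1) * M := integral_const_mul _ _
    _ ≤ 0 + ε := by
        rw [div_mul_eq_mul_div, zero_add, div_le_iff₀ (by positivity)]
        nlinarith

theorem integral_cos_int_mul (k : ℤ) :
    ∫ x in (0 : ℝ)..Real.pi, Real.cos (k * x) = if k = 0 then Real.pi else 0 := by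
  split_ifs with h
  · simp [h]
  · rw [intervalIntegral.integral_comp_mul_left (fun x => Real.cos x) (by exact_mod_cast h)]
    simp [Real.sin_int_mul_pi]

/-- The normalized cosine functions on `(0,π)`. -/
noncomputable def cosMap (n : ℕ) : C(ℝ, ℝ) :=
  ⟨fun x => (if n = 0 then √(1 / Real.pi) else √(2 / Real.pi)) * Real.cos (n * x), by fun_prop⟩

/-- The normalized sine functions on `(0,π)`; `sinMap 0 = 0`. -/
noncomputable def sinMap (n : ℕ) : C(ℝ, ℝ) :=
  ⟨fun x => √(2 / Real.pi) * Real.sin (n * x), by fun_prop⟩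

theorem integral_cosMap_mul_cosMap (m n : ℕ) :
    ∫ x in (0 : ℝ)..Real.pi, cosMap m x * cosMap n x = if m = n then 1 else 0 := by
  have h : ∀ x : ℝ, Real.cos (m * x) * Real.cos (n * x) =
      (Real.cos (((m - n : ℤ) : ℝ) * x) + Real.cos (((m + n : ℤ) : ℝ) * x)) / 2 := by
    intro x
    push_cast
    rw [sub_mul, add_mul, Real.cos_sub, Real.cos_add]; ring
  have hi : ∫ x in (0 : ℝ)..Real.pi, Real.cos (m * x) * Real.cos (n * x) =
      ((if (m - n : ℤ) = 0 then Real.pi else 0) + (if (m + n : ℤ) = 0 then Real.pi else 0)) / 2 := by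
    simp only [h]
    rw [intervalIntegral.integral_div, intervalIntegral.integral_add
      (Continuous.intervalIntegrable (by fun_prop) _ _)
      (Continuous.intervalIntegrable (by fun_prop) _ _), integral_cos_int_mul, integral_cos_int_mul]
  simp only [cosMap, ContinuousMap.coe_mk, mul_mul_mul_comm _ (Real.cos _)]
  rw [intervalIntegral.integral_const_mul, hi]
  by_cases hmn : m = n
  · subst hmn
    by_cases hm : m = 0
    · subst hm
      simp only [if_true, Nat.cast_zero, sub_self, add_zero]
      rw [Real.mul_self_sqrt (by positivity)]
      field_simp; norm_num
    · have : ¬ ((m : ℤ) + m = 0) := by omega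
      simp only [hm, this, sub_self, if_true, if_false]
      rw [Real.mul_self_sqrt (by positivity)]
      field_simp; norm_num
  · have h1 : ¬ ((m : ℤ) - n = 0) := by omega
    have h2 : ¬ ((m : ℤ) + n = 0) := by omega
    simp [hmn, h1, h2]

theorem integral_sinMap_mul_sinMap (m n : ℕ) :
    ∫ x in (0 : ℝ)..Real.pi, sinMap (m + 1) x * sinMap (n + 1) x = if m = n then 1 else 0 := by
  have h : ∀ x : ℝ, Real.sin (((m + 1 : ℕ) : ℝ) * x) * Real.sin (((n + 1 : ℕ) : ℝ) * x) =
      (Real.cos (((m - n : ℤ) : ℝ) * x) - Real.cos (((m + n + 2 : ℤ) : ℝ) * x)) / 2 := by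
    intro x
    have e1 : ((m - n : ℤ) : ℝ) * x = ((m + 1 : ℕ) : ℝ) * x - ((n + 1 : ℕ) : ℝ) * x := by
      push_cast; ring
    have e2 : ((m + n + 2 : ℤ) : ℝ) * x = ((m + 1 : ℕ) : ℝ) * x + ((n + 1 : ℕ) : ℝ) * x := by
      push_cast; ring
    rw [e1, e2, Real.cos_sub, Real.cos_add]; ring
  have hi : ∫ x in (0 : ℝ)..Real.pi,
      Real.sin (((m + 1 : ℕ) : ℝ) * x) * Real.sin (((n + 1 : ℕ) : ℝ) * x) =
      ((if (m - n : ℤ) = 0 then Real.pi else 0) -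
        (if (m + n + 2 : ℤ) = 0 then Real.pi else 0)) / 2 := by
    simp only [h]
    rw [intervalIntegral.integral_div, intervalIntegral.integral_sub
      (Continuous.intervalIntegrable (by fun_prop) _ _)
      (Continuous.intervalIntegrable (by fun_prop) _ _), integral_cos_int_mul, integral_cos_int_mul]
  simp only [sinMap, ContinuousMap.coe_mk, mul_mul_mul_comm _ (Real.sin _)]
  rw [intervalIntegral.integral_const_mul, hi, Real.mul_self_sqrt (by positivity)]
  have h2 : ¬ ((m : ℤ) + n + 2 = 0) := by omega
  by_cases hmn : m = n
  · subst hmn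
    simp only [h2, sub_self, if_true, if_false]
    field_simp; norm_num
  · have h1 : ¬ ((m : ℤ) - n = 0) := by omega
    simp [hmn, h1, h2]

theorem orthonormal_cos : Orthonormal 𝕜 (fun n => (ofReal (cosMap n) : L2 𝕜)) := by
  classical
  rw [orthonormal_iff_ite]
  intro m n
  rw [inner_ofReal_ofReal, integral_cosMap_mul_cosMap]
  split_ifs <;> simp

theorem orthonormal_sin : Orthonormal 𝕜 (fun n => (ofReal (sinMap (n + 1)) : L2 𝕜)) := by
  classical
  rw [orthonormal_iff_ite]
  intro m n
  rw [inner_ofReal_ofReal, integral_sinMap_mul_sinMap]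
  split_ifs <;> simp

/-- The product formula for cos x · cos(nx) carries orthogonality to all cos(nx) over to cos(x)^k
cos(nx) by induction on k; n = 0 leaves the powers of cos. Frequencies are taken in ℤ so that n - 1
is always allowed. -/
theorem eq_zero_of_inner_cos {f : L2 𝕜}
    (h : ∀ n : ℕ, inner 𝕜 (ofReal (cosMap n)) f = 0) : f = 0 := by
  have h0 : ∀ n : ℤ, ∫ x in Ioo (0 : ℝ) Real.pi, Real.cos (n * x) • f x = 0 := by
    have hN : ∀ n : ℕ, ∫ x in Ioo (0 : ℝ) Real.pi, Real.cos (n * x) • f x = 0 := by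
      intro n
      have := h n
      rw [inner_ofReal] at this
      simp only [cosMap, ContinuousMap.coe_mk, mul_smul] at this
      rw [integral_smul, smul_eq_zero] at this
      refine this.resolve_left ?_
      have := Real.pi_pos
      split_ifs <;> positivity
    intro n
    obtain ⟨m, rfl | rfl⟩ := n.eq_nat_or_neg
    · exact_mod_cast hN m
    · simpa using hN m
  have hk : ∀ k : ℕ, ∀ n : ℤ,
      ∫ x in Ioo (0 : ℝ) Real.pi, (Real.cos x ^ k * Real.cos (n * x)) • f x = 0 := by
    intro k
    induction k with
    | zero => simpa using h0
    | succ k ih =>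
      intro n
      have e : ∀ x : ℝ, (Real.cos x ^ (k + 1) * Real.cos (n * x)) • f x =
          (1 / 2 : ℝ) • ((Real.cos x ^ k * Real.cos ((n + 1 : ℤ) * x)) • f x +
            (Real.cos x ^ k * Real.cos ((n - 1 : ℤ) * x)) • f x) := by
        intro x
        rw [← add_smul, smul_smul]
        congr 1
        push_cast
        rw [sub_mul, add_mul, one_mul, Real.cos_sub, Real.cos_add]; ring
      simp only [e]
      rw [integral_smul, integral_add (integrable_smul_L2 (by fun_prop) f)
        (integrable_smul_L2 (by fun_prop) f), ih, ih, add_zero, smul_zero]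
  have := ae_eq_zero_of_integral_cos_pow (integrable_L2 f) fun k => by simpa using hk k 0
  exact Lp.eq_zero_iff_ae_eq_zero.2 this

/-- The same induction with n = 1 at the end shows that sin · f is orthogonal to all powers of cos;
sin is positive on (0,π), so it can be divided out. -/
theorem eq_zero_of_inner_sin {f : L2 𝕜}
    (h : ∀ n : ℕ, inner 𝕜 (ofReal (sinMap (n + 1))) f = 0) : f = 0 := by
  have h0 : ∀ n : ℤ, ∫ x in Ioo (0 : ℝ) Real.pi, Real.sin (n * x) • f x = 0 := by
    have hN : ∀ n : ℕ, ∫ x in Ioo (0 : ℝ) Real.pi, Real.sin (n * x) • f x = 0 := by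
      intro n
      rcases n with _ | n
      · simp
      have := h n
      rw [inner_ofReal] at this
      simp only [sinMap, ContinuousMap.coe_mk, mul_smul] at this
      rw [integral_smul, smul_eq_zero] at this
      refine this.resolve_left ?_
      have := Real.pi_pos
      positivity
    intro n
    obtain ⟨m, rfl | rfl⟩ := n.eq_nat_or_neg
    · exact_mod_cast hN m
    · have := hN m
      simp only [Int.cast_neg, Int.cast_natCast, neg_mul, Real.sin_neg, neg_smul]
      rw [integral_neg, this, neg_zero]
  have hk : ∀ k : ℕ, ∀ n : ℤ,
      ∫ x in Ioo (0 : ℝ) Real.pi, (Real.cos x ^ k * Real.sin (n * x)) • f x = 0 := by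
    intro k
    induction k with
    | zero => simpa using h0
    | succ k ih =>
      intro n
      have e : ∀ x : ℝ, (Real.cos x ^ (k + 1) * Real.sin (n * x)) • f x =
          (1 / 2 : ℝ) • ((Real.cos x ^ k * Real.sin ((n + 1 : ℤ) * x)) • f x +
            (Real.cos x ^ k * Real.sin ((n - 1 : ℤ) * x)) • f x) := by
        intro x
        rw [← add_smul, smul_smul]
        congr 1
        push_cast
        rw [sub_mul, add_mul, one_mul, Real.sin_sub, Real.sin_add]; ring
      simp only [e]
      rw [integral_smul, integral_add (integrable_smul_L2 (by fun_prop) f)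
        (integrable_smul_L2 (by fun_prop) f), ih, ih, add_zero, smul_zero]
  have := ae_eq_zero_of_integral_cos_pow (integrable_smul_L2 Real.continuous_sin f) fun k => by
    simpa [smul_smul] using hk k 1
  refine Lp.eq_zero_iff_ae_eq_zero.2 ?_
  filter_upwards [this, ae_restrict_mem measurableSet_Ioo] with x hx hx'
  exact (smul_eq_zero.1 hx).resolve_left (Real.sin_pos_of_mem_Ioo hx').ne'

theorem orthogonal_span_range_eq_bot {v : ℕ → L2 𝕜}
    (h : ∀ f, (∀ n, inner 𝕜 (v n) f = 0) → f = 0) : (Submodule.span 𝕜 (range v))ᗮ = ⊥ := by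
  rw [Submodule.eq_bot_iff]
  exact fun f hf => h f fun n =>
    (Submodule.mem_orthogonal _ _).1 hf _ (Submodule.subset_span (mem_range_self n))

/-- The orthonormal basis of the cosines. -/
noncomputable def cosBasis (𝕜 : Type*) [RCLike 𝕜] : HilbertBasis ℕ 𝕜 (L2 𝕜) :=
  HilbertBasis.mkOfOrthogonalEqBot orthonormal_cos
    (orthogonal_span_range_eq_bot fun _ => eq_zero_of_inner_cos)

/-- The orthonormal basis of the sines. -/
noncomputable def sinBasis (𝕜 : Type*) [RCLike 𝕜] : HilbertBasis ℕ 𝕜 (L2 𝕜) :=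
  HilbertBasis.mkOfOrthogonalEqBot orthonormal_sin
    (orthogonal_span_range_eq_bot fun _ => eq_zero_of_inner_sin)

theorem cosBasis_apply (n : ℕ) : cosBasis 𝕜 n = ofReal (cosMap n) := by
  simp [cosBasis]

theorem sinBasis_apply (n : ℕ) : sinBasis 𝕜 n = ofReal (sinMap (n + 1)) := by
  simp [sinBasis]

/-- The cosine coefficients of an element of `L²(0,π)`. -/
noncomputable def cosC (n : ℕ) : L2 𝕜 →L[ℝ] 𝕜 :=
  (innerSL 𝕜 (ofReal (cosMap n) : L2 𝕜)).restrictScalars ℝ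

/-- The sine coefficients of an element of `L²(0,π)`; the one of index `0` is zero. -/
noncomputable def sinC (n : ℕ) : L2 𝕜 →L[ℝ] 𝕜 :=
  (innerSL 𝕜 (ofReal (sinMap n) : L2 𝕜)).restrictScalars ℝ

theorem cosC_apply (n : ℕ) (f : L2 𝕜) : cosC n f = inner 𝕜 (ofReal (cosMap n)) f := rfl

theorem sinC_apply (n : ℕ) (f : L2 𝕜) : sinC n f = inner 𝕜 (ofReal (sinMap n)) f := rfl

theorem cosC_eq_integral (n : ℕ) (f : L2 𝕜) :
    cosC n f = ∫ x in Ioo (0 : ℝ) Real.pi, cosMap n x • f x := inner_ofReal _ _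

theorem sinC_eq_integral (n : ℕ) (f : L2 𝕜) :
    sinC n f = ∫ x in Ioo (0 : ℝ) Real.pi, sinMap n x • f x := inner_ofReal _ _

theorem sinC_zero (f : L2 𝕜) : sinC 0 f = 0 := by
  simp [sinC_eq_integral, sinMap]

theorem cosC_ext {f g : L2 𝕜} (h : ∀ n, cosC n f = cosC n g) : f = g :=
  sub_eq_zero.1 <| eq_zero_of_inner_cos fun n => by
    rw [← cosC_apply, map_sub, h, sub_self]

theorem sinC_ext {f g : L2 𝕜} (h : ∀ n, sinC n f = sinC n g) : f = g :=
  sub_eq_zero.1 <| eq_zero_of_inner_sin fun n => by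
    rw [← sinC_apply, map_sub, h, sub_self]

theorem summable_cosC_sq (f : L2 𝕜) : Summable fun n => ‖cosC n f‖ ^ 2 :=
  orthonormal_cos.inner_products_summable f

theorem summable_sinC_sq (f : L2 𝕜) : Summable fun n => ‖sinC n f‖ ^ 2 :=
  (summable_nat_add_iff 1).1 (orthonormal_sin.inner_products_summable f)

theorem mem_L2m_iff (f : L2 𝕜) : f ∈ L2m 𝕜 ↔ cosC 0 f = 0 := by
  have h : √(1 / Real.pi) ≠ 0 := by have := Real.pi_pos; positivity
  rw [cosC_eq_integral]
  simp only [cosMap, ContinuousMap.coe_mk, if_true, Nat.cast_zero, zero_mul, Real.cos_zero, mul_one]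
  rw [integral_smul, smul_eq_zero, or_iff_right h]
  rfl

/-- A family of continuous coefficients with a square summable bound is the family of coefficients
of a continuous curve. -/
theorem exists_continuous_coeff {H : Type*} [NormedAddCommGroup H] [InnerProductSpace 𝕜 H]
    [CompleteSpace H] (e : HilbertBasis ℕ 𝕜 H) {c : ℕ → ℝ → 𝕜} {d : ℕ → ℝ}
    (hc : ∀ n, Continuous (c n)) (hd : Summable fun n => d n ^ 2) (hcd : ∀ n t, ‖c n t‖ ≤ d n) :
    ∃ V : ℝ → H, Continuous V ∧ ∀ n t, inner 𝕜 (e n) (V t) = c n t := by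
  have hmem : ∀ t, Memℓp (fun n => c n t) 2 := fun t => by
    refine memℓp_gen (Summable.of_nonneg_of_le (fun n => by positivity) (fun n => ?_) hd)
    simpa using pow_le_pow_left₀ (norm_nonneg _) (hcd n t) 2
  set W : ℝ → lp (fun _ : ℕ => 𝕜) 2 := fun t => ⟨fun n => c n t, hmem t⟩ with hW
  have hWc : Continuous W := by
    rw [continuous_iff_continuousAt]
    intro t
    rw [ContinuousAt, tendsto_iff_norm_sub_tendsto_zero]
    have hsq : ∀ s, ‖W s - W t‖ = √(∑' n, ‖c n s - c n t‖ ^ 2) := by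
      intro s
      have := lp.norm_rpow_eq_tsum (p := 2) (by norm_num) (W s - W t)
      simp only [ENNReal.toReal_ofNat, Real.rpow_two] at this
      rw [← Real.sqrt_sq (norm_nonneg (W s - W t)), this]
      rfl
    simp only [hsq]
    -- Continuity in ℓ² is dominated convergence for series: each term tends to 0 and is at most (2
    -- d n)².
    have h1 : Filter.Tendsto (fun s => ∑' n, ‖c n s - c n t‖ ^ 2) (nhds t)
        (nhds (∑' _ : ℕ, (0 : ℝ))) := by
      refine tendsto_tsum_of_dominated_convergence (bound := fun n => 4 * d n ^ 2)
        (hd.mul_left 4) (fun n => ?_) (Filter.Eventually.of_forall fun s n => ?_)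
      · have : Continuous fun s => ‖c n s - c n t‖ ^ 2 := by
          have := hc n
          fun_prop
        simpa using this.tendsto t
      · rw [Real.norm_of_nonneg (by positivity)]
        have : ‖c n s - c n t‖ ≤ 2 * d n :=
          (norm_sub_le _ _).trans (by linarith [hcd n s, hcd n t])
        calc ‖c n s - c n t‖ ^ 2 ≤ (2 * d n) ^ 2 := by gcongr
          _ = 4 * d n ^ 2 := by ring
    simpa [Function.comp_def] using (Real.continuous_sqrt.tendsto _).comp h1
  refine ⟨fun t => e.repr.symm (W t), e.repr.symm.continuous.comp hWc, fun n t => ?_⟩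
  rw [← HilbertBasis.repr_apply_apply, LinearIsometryEquiv.apply_symm_apply]

theorem exists_continuous_cosC {c : ℕ → ℝ → 𝕜} {d : ℕ → ℝ}
    (hc : ∀ n, Continuous (c n)) (hd : Summable fun n => d n ^ 2) (hcd : ∀ n t, ‖c n t‖ ≤ d n) :
    ∃ V : ℝ → L2 𝕜, Continuous V ∧ ∀ n t, cosC n (V t) = c n t := by
  obtain ⟨V, hV, h⟩ := exists_continuous_coeff (cosBasis 𝕜) hc hd hcd
  exact ⟨V, hV, fun n t => by rw [← h, cosBasis_apply, cosC_apply]⟩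

theorem exists_continuous_sinC {c : ℕ → ℝ → 𝕜} {d : ℕ → ℝ} (hc0 : ∀ t, c 0 t = 0)
    (hc : ∀ n, Continuous (c n)) (hd : Summable fun n => d n ^ 2) (hcd : ∀ n t, ‖c n t‖ ≤ d n) :
    ∃ V : ℝ → L2 𝕜, Continuous V ∧ ∀ n t, sinC n (V t) = c n t := by
  obtain ⟨V, hV, h⟩ := exists_continuous_coeff (sinBasis 𝕜) (c := fun n => c (n + 1))
    (fun n => hc _) ((summable_nat_add_iff 1).2 hd) fun n t => hcd _ _
  refine ⟨V, hV, fun n t => ?_⟩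
  rcases n with _ | n
  · rw [sinC_zero, hc0]
  · rw [← h, sinBasis_apply, sinC_apply]

end TrigonometricBases

/-! ### From coefficient relations to weak derivatives and boundary values. -/

section WeakDerivatives

variable {𝕜 : Type*} [RCLike 𝕜]

theorem hasDerivAt_cosMap (n : ℕ) (x : ℝ) : HasDerivAt (cosMap n) (-(n * sinMap n x)) x := by
  have h : HasDerivAt (fun x : ℝ => (if n = 0 then √(1 / Real.pi) else √(2 / Real.pi)) *
      Real.cos (n * x)) ((if n = 0 then √(1 / Real.pi) else √(2 / Real.pi)) *
      (-Real.sin (n * x) * (n * 1))) x :=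
    (((hasDerivAt_id x).const_mul (n : ℝ)).cos).const_mul _
  refine h.congr_deriv ?_
  rcases eq_or_ne n 0 with rfl | hn
  · simp
  · simp only [sinMap, ContinuousMap.coe_mk, hn, if_false]; ring

theorem hasDerivAt_sinMap (n : ℕ) (x : ℝ) : HasDerivAt (sinMap n) (n * cosMap n x) x := by
  have h : HasDerivAt (fun x : ℝ => √(2 / Real.pi) * Real.sin (n * x))
      (√(2 / Real.pi) * (Real.cos (n * x) * (n * 1))) x :=
    (((hasDerivAt_id x).const_mul (n : ℝ)).sin).const_mul _
  refine h.congr_deriv ?_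
  rcases eq_or_ne n 0 with rfl | hn
  · simp
  · simp only [cosMap, ContinuousMap.coe_mk, hn, if_false]; ring

theorem contDiff_cosMap (n : ℕ) : ContDiff ℝ ∞ (cosMap n) := by
  simp only [cosMap, ContinuousMap.coe_mk]
  fun_prop

theorem contDiff_sinMap (n : ℕ) : ContDiff ℝ ∞ (sinMap n) := by
  simp only [sinMap, ContinuousMap.coe_mk]
  fun_prop

theorem integral_deriv_mul_of_vanishing {φ ψ ψ' : ℝ → ℝ} (hφ : ContDiff ℝ ∞ φ)
    (h0 : φ 0 = 0) (hπ : φ Real.pi = 0) (hψ : ∀ x, HasDerivAt ψ (ψ' x) x)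
    (hψ' : Continuous ψ') :
    ∫ x in (0 : ℝ)..Real.pi, deriv φ x * ψ x = -∫ x in (0 : ℝ)..Real.pi, φ x * ψ' x := by
  have h := intervalIntegral.integral_mul_deriv_eq_deriv_mul (a := 0) (b := Real.pi)
    (u := φ) (v := ψ) (fun x _ => (hφ.differentiable (by simp) x).hasDerivAt)
    (fun x _ => hψ x) ((hφ.continuous_deriv (by simp)).intervalIntegrable _ _)
    (hψ'.intervalIntegrable _ _)
  rw [h, h0, hπ]
  ring

theorem eq_zero_of_tsupport_subset {φ : ℝ → ℝ} (h : tsupport φ ⊆ Ioo 0 Real.pi) :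
    φ 0 = 0 ∧ φ Real.pi = 0 :=
  ⟨image_eq_zero_of_notMem_tsupport fun h' => lt_irrefl _ (h h').1,
    image_eq_zero_of_notMem_tsupport fun h' => lt_irrefl _ (h h').2⟩

/-- Parseval: the pairing of φ' with u is computed in the sine basis and that of φ with v in the
cosine basis. Integration by parts on each basis function matches the two series term by term. -/
theorem hasWeakDeriv_of_cosC {u v : L2 𝕜} (h : ∀ n, cosC n v = (n : 𝕜) * sinC n u) :
    HasWeakDeriv u v := by
  intro φ hφ _ hφs
  obtain ⟨h0, hπ⟩ := eq_zero_of_tsupport_subset hφs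
  set Φ : C(ℝ, ℝ) := ⟨φ, hφ.continuous⟩
  set Φ' : C(ℝ, ℝ) := ⟨deriv φ, hφ.continuous_deriv (by simp)⟩
  have e1 : ∫ x in Ioo (0 : ℝ) Real.pi, deriv φ x • u x = inner 𝕜 (ofReal Φ') u :=
    (inner_ofReal Φ' u).symm
  have e2 : ∫ x in Ioo (0 : ℝ) Real.pi, φ x • v x = inner 𝕜 (ofReal Φ) v :=
    (inner_ofReal Φ v).symm
  have hib : ∀ n, inner 𝕜 (ofReal Φ') (ofReal (sinMap n) : L2 𝕜) =
      -((n : 𝕜) * inner 𝕜 (ofReal Φ) (ofReal (cosMap n) : L2 𝕜)) := by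
    intro n
    rw [inner_ofReal_ofReal, inner_ofReal_ofReal]
    have := integral_deriv_mul_of_vanishing hφ h0 hπ (hasDerivAt_sinMap n) (by fun_prop)
    simp only [mul_left_comm _ (n : ℝ)] at this
    rw [intervalIntegral.integral_const_mul] at this
    simp only [Φ, Φ', ContinuousMap.coe_mk]
    rw [this]; push_cast; rfl
  rw [e1, e2]
  have s1 := (sinBasis 𝕜).hasSum_inner_mul_inner (ofReal Φ') u
  -- The sine basis is indexed from frequency 1, so the cosine series is shifted by one; its term of
  -- index 0 vanishes because the mean of v does.
  have s2 := (hasSum_nat_add_iff' 1).2 ((cosBasis 𝕜).hasSum_inner_mul_inner (ofReal Φ) v)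
  simp only [sinBasis_apply] at s1
  simp only [cosBasis_apply, Finset.range_one, Finset.sum_singleton] at s2
  have hv0 : inner 𝕜 (ofReal (cosMap 0)) v = 0 := by simpa [cosC_apply] using h 0
  rw [hv0, mul_zero, sub_zero] at s2
  refine s1.unique (s2.neg.congr_fun fun n => ?_)
  have := h (n + 1)
  rw [cosC_apply, sinC_apply] at this
  rw [this, hib]; ring

theorem hasWeakDeriv_of_sinC {q v : L2 𝕜} (h : ∀ n, sinC n v = -((n : 𝕜) * cosC n q)) :
    HasWeakDeriv q v := by
  intro φ hφ _ hφs
  obtain ⟨h0, hπ⟩ := eq_zero_of_tsupport_subset hφs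
  set Φ : C(ℝ, ℝ) := ⟨φ, hφ.continuous⟩
  set Φ' : C(ℝ, ℝ) := ⟨deriv φ, hφ.continuous_deriv (by simp)⟩
  have e1 : ∫ x in Ioo (0 : ℝ) Real.pi, deriv φ x • q x = inner 𝕜 (ofReal Φ') q :=
    (inner_ofReal Φ' q).symm
  have e2 : ∫ x in Ioo (0 : ℝ) Real.pi, φ x • v x = inner 𝕜 (ofReal Φ) v :=
    (inner_ofReal Φ v).symm
  have hib : ∀ n, inner 𝕜 (ofReal Φ') (ofReal (cosMap n) : L2 𝕜) =
      (n : 𝕜) * inner 𝕜 (ofReal Φ) (ofReal (sinMap n) : L2 𝕜) := by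
    intro n
    rw [inner_ofReal_ofReal, inner_ofReal_ofReal]
    have := integral_deriv_mul_of_vanishing hφ h0 hπ (hasDerivAt_cosMap n) (by fun_prop)
    simp only [mul_neg, mul_left_comm _ (n : ℝ)] at this
    rw [intervalIntegral.integral_neg, neg_neg, intervalIntegral.integral_const_mul] at this
    simp only [Φ, Φ', ContinuousMap.coe_mk]
    rw [this]; push_cast; rfl
  rw [e1, e2]
  have s1 := (hasSum_nat_add_iff' 1).2 ((cosBasis 𝕜).hasSum_inner_mul_inner (ofReal Φ') q)
  have s2 := (sinBasis 𝕜).hasSum_inner_mul_inner (ofReal Φ) v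
  simp only [sinBasis_apply] at s2
  simp only [cosBasis_apply, Finset.range_one, Finset.sum_singleton] at s1
  -- Here the lost cosine term vanishes because φ' has zero mean.
  rw [hib 0, Nat.cast_zero, zero_mul, zero_mul, sub_zero] at s1
  refine s1.unique (s2.neg.congr_fun fun n => ?_)
  have := h (n + 1)
  rw [cosC_apply, sinC_apply] at this
  rw [this, hib]; ring

/-- Since n u_n is square summable, u_n is absolutely summable. The sine series of u then converges
uniformly, and its continuous sum vanishes at 0 and π with every term. -/
theorem vanishesAtEnds_of_cosC {u v : L2 𝕜} (h : ∀ n, cosC n v = (n : 𝕜) * sinC n u) :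
    VanishesAtEnds u := by
  have hb : ∀ n : ℕ, ∀ x : ℝ, ‖((sinMap n x : ℝ) : 𝕜)‖ ≤ √(2 / Real.pi) := by
    intro n x
    rw [RCLike.norm_ofReal]
    simp only [sinMap, ContinuousMap.coe_mk]
    rw [abs_mul, abs_of_nonneg (Real.sqrt_nonneg _)]
    exact mul_le_of_le_one_right (Real.sqrt_nonneg _) (Real.abs_sin_le_one _)
  set b : ℕ → BoundedContinuousFunction ℝ 𝕜 := fun n =>
    BoundedContinuousFunction.ofNormedAddCommGroup (fun x => ((sinMap (n + 1) x : ℝ) : 𝕜))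
      (RCLike.continuous_ofReal.comp (sinMap (n + 1)).continuous) _ (hb (n + 1)) with hbdef
  have hbn : ∀ n, ‖b n‖ ≤ √(2 / Real.pi) := fun n =>
    BoundedContinuousFunction.norm_ofNormedAddCommGroup_le _ (Real.sqrt_nonneg _) _
  have hLp : ∀ n, BoundedContinuousFunction.toLp 2 (volume.restrict (Ioo (0 : ℝ) Real.pi)) 𝕜 (b n) =
      sinBasis 𝕜 n := by
    intro n
    rw [sinBasis_apply]
    refine Lp.ext ?_
    filter_upwards [BoundedContinuousFunction.coeFn_toLp 2
      (volume.restrict (Ioo (0 : ℝ) Real.pi)) 𝕜 (b n), coeFn_ofReal (𝕜 := 𝕜) (sinMap (n + 1))]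
      with x h1 h2
    rw [h1, h2]; rfl
  have hU : Summable fun n => ‖sinC (n + 1) u‖ := by
    have s1 := (summable_nat_add_iff 1).2 (summable_cosC_sq v)
    have s2 : Summable fun n : ℕ => 1 / ((n + 1 : ℕ) : ℝ) ^ 2 :=
      (summable_nat_add_iff 1).2 (Real.summable_one_div_nat_pow.2 one_lt_two)
    refine Summable.of_nonneg_of_le (fun n => norm_nonneg _) (fun n => ?_) (s1.add s2)
    rw [h, norm_mul, RCLike.norm_natCast]
    set y := ‖sinC (n + 1) u‖
    set m := ((n + 1 : ℕ) : ℝ)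
    have hm : 0 < m := by positivity
    -- The product is bounded by the sum of the squares of its factors, both summable.
    have hy : y = (m * y) * (1 / m) := by field_simp
    have : (1 / m) ^ 2 = 1 / m ^ 2 := by ring
    nlinarith [sq_nonneg (m * y - 1 / m), sq_nonneg (m * y), sq_nonneg (1 / m)]
  have hs : Summable fun n => sinC (n + 1) u • b n := by
    refine Summable.of_norm_bounded (hU.mul_right (√(2 / Real.pi))) fun n => ?_
    rw [norm_smul]
    exact mul_le_mul_of_nonneg_left (hbn n) (norm_nonneg _)
  set G : BoundedContinuousFunction ℝ 𝕜 := ∑' n, sinC (n + 1) u • b n with hG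
  have hGu : BoundedContinuousFunction.toLp 2 (volume.restrict (Ioo (0 : ℝ) Real.pi)) 𝕜 G = u := by
    have h1 := (BoundedContinuousFunction.toLp 2
      (volume.restrict (Ioo (0 : ℝ) Real.pi)) 𝕜 (E := 𝕜)).hasSum hs.hasSum
    have h2 : HasSum (fun n => sinC (n + 1) u • sinBasis 𝕜 n) u := by
      refine ((sinBasis 𝕜).hasSum_repr u).congr_fun fun n => ?_
      have : (sinBasis 𝕜).repr u n = sinC (n + 1) u := by
        rw [HilbertBasis.repr_apply_apply, sinBasis_apply, sinC_apply]
      exact congrArg (· • sinBasis 𝕜 n) this.symm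
    refine h1.unique (h2.congr_fun fun n => ?_)
    rw [map_smul, hLp]
  have hends : ∀ x : ℝ, (∀ n : ℕ, Real.sin (n * x) = 0) → G x = 0 := by
    intro x hx
    have h1 := (BoundedContinuousFunction.evalCLM 𝕜 x (β := 𝕜)).hasSum hs.hasSum
    refine h1.unique ?_
    refine hasSum_zero.congr_fun fun n => ?_
    rw [map_smul]
    simp [hbdef, sinMap, BoundedContinuousFunction.evalCLM_apply,
      BoundedContinuousFunction.coe_ofNormedAddCommGroup, -Nat.cast_add, hx]
  refine ⟨G, G.continuous.continuousOn, ?_, hends 0 (by simp), hends _ Real.sin_nat_mul_pi⟩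
  filter_upwards [BoundedContinuousFunction.coeFn_toLp 2
    (volume.restrict (Ioo (0 : ℝ) Real.pi)) 𝕜 G] with x hx
  rw [← hGu, hx]

end WeakDerivatives

/-! ### From weak derivatives and boundary values to coefficient relations. -/

section TracesOfWeakDerivatives

variable {𝕜 : Type*} [RCLike 𝕜]

theorem exists_bound_deriv_smoothTransition :
    ∃ C : ℝ, 0 ≤ C ∧ ∀ x, |deriv Real.smoothTransition x| ≤ C := by
  have hcont : Continuous (deriv Real.smoothTransition) :=
    (Real.smoothTransition.contDiff (n := 1)).continuous_deriv le_rfl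
  obtain ⟨C, hC⟩ := (isCompact_Icc (a := (0 : ℝ)) (b := 1)).exists_bound_of_continuousOn
    hcont.continuousOn
  have hC0 : 0 ≤ C := (norm_nonneg _).trans (hC 0 (by simp))
  refine ⟨C, hC0, fun x => ?_⟩
  rcases lt_or_ge x 0 with h | h
  · have : Real.smoothTransition =ᶠ[nhds x] fun _ => 0 := by
      filter_upwards [Iio_mem_nhds h] with y hy
      exact Real.smoothTransition.zero_of_nonpos (le_of_lt hy)
    rw [this.deriv_eq]; simpa using hC0
  rcases le_or_gt x 1 with h' | h'
  · exact hC x ⟨h, h'⟩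
  · have : Real.smoothTransition =ᶠ[nhds x] fun _ => 1 := by
      filter_upwards [Ioi_mem_nhds h'] with y hy
      exact Real.smoothTransition.one_of_one_le (le_of_lt hy)
    rw [this.deriv_eq]; simpa using hC0

theorem tendsto_two_div_add_one :
    Filter.Tendsto (fun k : ℕ => 2 / (k + 1 : ℝ)) Filter.atTop (nhds 0) := by
  have := (tendsto_one_div_add_atTop_nhds_zero_nat (𝕜 := ℝ)).const_mul 2
  simpa only [mul_one_div, mul_zero] using this

/-- Cutoff functions that exhaust the interval `(0,π)`. -/
theorem exists_cutoff : ∃ (χ : ℕ → ℝ → ℝ) (C : ℝ), 0 ≤ C ∧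
    (∀ k, ContDiff ℝ ∞ (χ k)) ∧ (∀ k, tsupport (χ k) ⊆ Ioo 0 Real.pi) ∧
    (∀ (k : ℕ) (x : ℝ), |χ k x| ≤ 1) ∧ (∀ x ∈ Ioo 0 Real.pi, ∀ᶠ k in Filter.atTop, χ k x = 1) ∧
    (∀ (k : ℕ) (x : ℝ), |deriv (χ k) x| ≤ C * (k + 1)) ∧
    (∀ (k : ℕ) (x : ℝ), 2 / (k + 1 : ℝ) < x → 2 / (k + 1 : ℝ) < Real.pi - x → deriv (χ k) x = 0) := by
  obtain ⟨C, hC0, hC⟩ := exists_bound_deriv_smoothTransition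
  -- χ k is supported at distance at least 1/(k+1) from both ends and equals 1 at distance at least
  -- 2/(k+1), so its derivative is O(k) and lives in two layers of width O(1/k).
  set χ : ℕ → ℝ → ℝ := fun k x => Real.smoothTransition ((k + 1) * x - 1) *
    Real.smoothTransition ((k + 1) * (Real.pi - x) - 1) with hχ
  have hst : ContDiff ℝ ∞ Real.smoothTransition := Real.smoothTransition.contDiff
  have hd : ∀ (k : ℕ) (x : ℝ), HasDerivAt (χ k)
      (deriv Real.smoothTransition ((k + 1) * x - 1) * (k + 1) *
        Real.smoothTransition ((k + 1) * (Real.pi - x) - 1) +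
      Real.smoothTransition ((k + 1) * x - 1) *
        (deriv Real.smoothTransition ((k + 1) * (Real.pi - x) - 1) * (-(k + 1)))) x := by
    intro k x
    have hdst : ∀ y, HasDerivAt Real.smoothTransition (deriv Real.smoothTransition y) y :=
      fun y => (hst.differentiable (by simp) y).hasDerivAt
    have h1 : HasDerivAt (fun x : ℝ => (k + 1 : ℝ) * x - 1) (k + 1) x := by
      simpa using ((hasDerivAt_id x).const_mul (k + 1 : ℝ)).sub_const 1
    have h2 : HasDerivAt (fun x : ℝ => (k + 1 : ℝ) * (Real.pi - x) - 1) (-(k + 1)) x := by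
      simpa using (((hasDerivAt_id x).const_sub Real.pi).const_mul (k + 1 : ℝ)).sub_const 1
    exact ((hdst _).comp x h1).mul ((hdst _).comp x h2)
  have hone : ∀ (k : ℕ) (x : ℝ), 2 / (k + 1 : ℝ) ≤ x → 2 / (k + 1 : ℝ) ≤ Real.pi - x → χ k x = 1 := by
    intro k x h1 h2
    rw [div_le_iff₀ (by positivity)] at h1 h2
    simp only [hχ]
    rw [Real.smoothTransition.one_of_one_le (by linarith),
      Real.smoothTransition.one_of_one_le (by linarith), one_mul]
  refine ⟨χ, 2 * C, by positivity, fun k => ?_, fun k => ?_, fun k x => ?_, fun x hx => ?_,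
    fun k x => ?_, fun k x h1 h2 => ?_⟩
  · exact (hst.comp (by fun_prop)).mul (hst.comp (by fun_prop))
  · have hpos : (0 : ℝ) < 1 / (k + 1) := by positivity
    have hsub : tsupport (χ k) ⊆ Icc (1 / (k + 1 : ℝ)) (Real.pi - 1 / (k + 1)) := by
      refine closure_minimal (fun x hx => ?_) isClosed_Icc
      rw [Function.mem_support] at hx
      have h1 := left_ne_zero_of_mul hx
      have h2 := right_ne_zero_of_mul hx
      rw [Ne, Real.smoothTransition.zero_iff_nonpos, not_le] at h1 h2
      refine ⟨?_, ?_⟩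
      · rw [div_le_iff₀ (by positivity)]; linarith
      · rw [le_sub_comm, div_le_iff₀ (by positivity)]; linarith
    exact hsub.trans fun x hx => ⟨by linarith [hx.1], by linarith [hx.2]⟩
  · rw [abs_of_nonneg (mul_nonneg (Real.smoothTransition.nonneg _)
      (Real.smoothTransition.nonneg _))]
    exact mul_le_one₀ (Real.smoothTransition.le_one _) (Real.smoothTransition.nonneg _)
      (Real.smoothTransition.le_one _)
  · have ht := tendsto_two_div_add_one
    filter_upwards [ht.eventually_le_const hx.1, ht.eventually_le_const (sub_pos.2 hx.2)]
      with k h1 h2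
    exact hone k x h1 h2
  · rw [(hd k x).deriv]
    have hst1 : ∀ y, |Real.smoothTransition y| ≤ 1 := fun y => by
      rw [abs_of_nonneg (Real.smoothTransition.nonneg _)]
      exact Real.smoothTransition.le_one _
    have hk : (0 : ℝ) ≤ k + 1 := by positivity
    refine (abs_add_le _ _).trans ?_
    rw [abs_mul, abs_mul, abs_mul, abs_mul, abs_neg, abs_of_nonneg hk]
    have e1 : |deriv Real.smoothTransition ((k + 1) * x - 1)| * (k + 1) *
        |Real.smoothTransition ((k + 1) * (Real.pi - x) - 1)| ≤ C * (k + 1) * 1 := by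
      gcongr
      · exact hC _
      · exact hst1 _
    have e2 : |Real.smoothTransition ((k + 1) * x - 1)| *
        (|deriv Real.smoothTransition ((k + 1) * (Real.pi - x) - 1)| * (k + 1)) ≤
        1 * (C * (k + 1)) := by
      gcongr
      · exact hst1 _
      · exact hC _
    linarith
  · have : χ k =ᶠ[nhds x] fun _ => 1 := by
      filter_upwards [Ioi_mem_nhds h1, Iio_mem_nhds (lt_sub_comm.1 h2)] with y hy1 hy2
      exact hone k y (le_of_lt hy1) (le_of_lt (lt_sub_comm.1 hy2))
    rw [this.deriv_eq]; simp

/-- Integration by parts against a smooth function `ψ` that need not vanish at the ends, provided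
that the boundary terms tend to zero. -/
theorem HasWeakDeriv.integral_eq {u v : L2 𝕜} (h : HasWeakDeriv u v) {χ : ℕ → ℝ → ℝ}
    (hχ : ∀ k, ContDiff ℝ ∞ (χ k)) (hs : ∀ k, tsupport (χ k) ⊆ Ioo 0 Real.pi)
    (h1 : ∀ k x, |χ k x| ≤ 1)
    (hlim : ∀ x ∈ Ioo 0 Real.pi, ∀ᶠ k in Filter.atTop, χ k x = 1)
    {ψ : ℝ → ℝ} (hψ : ContDiff ℝ ∞ ψ)
    (hb : Filter.Tendsto (fun k => ∫ x in Ioo (0 : ℝ) Real.pi, (deriv (χ k) x * ψ x) • u x)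
      Filter.atTop (nhds 0)) :
    ∫ x in Ioo (0 : ℝ) Real.pi, deriv ψ x • u x = -∫ x in Ioo (0 : ℝ) Real.pi, ψ x • v x := by
  have hψ' : Continuous (deriv ψ) := hψ.continuous_deriv (by simp)
  have hχ' : ∀ k, Continuous (deriv (χ k)) := fun k => (hχ k).continuous_deriv (by simp)
  have key : ∀ k, ∫ x in Ioo (0 : ℝ) Real.pi, (χ k x * deriv ψ x) • u x =
      -(∫ x in Ioo (0 : ℝ) Real.pi, (χ k x * ψ x) • v x) -
        ∫ x in Ioo (0 : ℝ) Real.pi, (deriv (χ k) x * ψ x) • u x := by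
    intro k
    have ht : tsupport (fun x => χ k x * ψ x) ⊆ tsupport (χ k) := tsupport_mul_subset_left
    have hc : HasCompactSupport (fun x => χ k x * ψ x) :=
      IsCompact.of_isClosed_subset isCompact_Icc (isClosed_tsupport _)
        ((ht.trans (hs k)).trans Ioo_subset_Icc_self)
    have := h (fun x => χ k x * ψ x) ((hχ k).mul hψ) hc (ht.trans (hs k))
    have hd : ∀ x, deriv (fun x => χ k x * ψ x) x = deriv (χ k) x * ψ x + χ k x * deriv ψ x :=
      fun x => deriv_fun_mul ((hχ k).differentiable (by simp) x) (hψ.differentiable (by simp) x)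
    simp only [hd, add_smul] at this
    have i1 : Integrable (fun x => (deriv (χ k) x * ψ x) • u x)
        (volume.restrict (Ioo (0 : ℝ) Real.pi)) :=
      integrable_smul_L2 ((hχ' k).mul hψ.continuous) u
    have i2 : Integrable (fun x => (χ k x * deriv ψ x) • u x)
        (volume.restrict (Ioo (0 : ℝ) Real.pi)) :=
      integrable_smul_L2 ((hχ k).continuous.mul hψ') u
    rw [integral_add i1 i2] at this
    rw [← this]; ring
  have hconv : ∀ {f : ℝ → ℝ} (w : L2 𝕜), Continuous f →
      Filter.Tendsto (fun k => ∫ x in Ioo (0 : ℝ) Real.pi, (χ k x * f x) • w x) Filter.atTop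
        (nhds (∫ x in Ioo (0 : ℝ) Real.pi, f x • w x)) := by
    intro f w hf
    refine tendsto_integral_of_dominated_convergence (fun x => ‖f x • w x‖)
      (fun k => (integrable_smul_L2 ((hχ k).continuous.mul hf) w).aestronglyMeasurable)
      (integrable_smul_L2 hf w).norm (fun k => ?_) ?_
    · filter_upwards with x
      rw [mul_smul, norm_smul]
      exact mul_le_of_le_one_left (norm_nonneg _) (h1 k x)
    · filter_upwards [ae_restrict_mem measurableSet_Ioo] with x hx
      refine tendsto_const_nhds.congr' ?_
      filter_upwards [hlim x hx] with k hk
      rw [hk, one_mul]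
  have l1 := hconv u hψ'
  have l2 := (hconv v hψ.continuous).neg.sub hb
  simp only [key] at l1
  rw [sub_zero] at l2
  exact tendsto_nhds_unique l1 l2

/-- No boundary condition on q is needed: the test function sin(nx) is O(1/k) in the layers where
the cutoff has slope O(k), so the boundary integrand is dominated by a multiple of |q| and vanishes
pointwise in the limit. -/
theorem HasWeakDeriv.sinC_eq {q v : L2 𝕜} (h : HasWeakDeriv q v) (n : ℕ) :
    sinC n v = -((n : 𝕜) * cosC n q) := by
  obtain ⟨χ, C, hC0, hχ, hs, h1, hlim, hC, hz⟩ := exists_cutoff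
  have hd : ∀ x, deriv (sinMap n) x = n * cosMap n x := fun x => (hasDerivAt_sinMap n x).deriv
  obtain ⟨L, hL0, hL⟩ : ∃ L : ℝ, 0 ≤ L ∧ ∀ x, |sinMap n x| ≤ L * |x| ∧
      |sinMap n x| ≤ L * |Real.pi - x| := by
    refine ⟨√(2 / Real.pi) * n, by positivity, fun x => ?_⟩
    have hsin : ∀ y, |sinMap n y| ≤ √(2 / Real.pi) * n * |y| := by
      intro y
      simp only [sinMap, ContinuousMap.coe_mk]
      rw [abs_mul, abs_of_nonneg (Real.sqrt_nonneg _), mul_assoc]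
      refine mul_le_mul_of_nonneg_left ?_ (Real.sqrt_nonneg _)
      have : |Real.sin (n * y)| ≤ |n * y| := Real.abs_sin_le_abs
      rwa [abs_mul, Nat.abs_cast] at this
    refine ⟨hsin x, ?_⟩
    have : |sinMap n x| = |sinMap n (Real.pi - x)| := by
      simp only [sinMap, ContinuousMap.coe_mk]
      rw [abs_mul, abs_mul, mul_sub, Real.sin_nat_mul_pi_sub]
      simp [abs_mul]
    rw [this]
    exact hsin _
  have hpt : ∀ k, ∀ x ∈ Ioo (0 : ℝ) Real.pi, |deriv (χ k) x * sinMap n x| ≤ 2 * C * L := by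
    intro k x hx
    have hk : (0 : ℝ) < k + 1 := by positivity
    have hfin : ∀ y, 0 < y → y ≤ 2 / (k + 1 : ℝ) → |sinMap n x| ≤ L * |y| →
        |deriv (χ k) x * sinMap n x| ≤ 2 * C * L := by
      intro y hy0 hy hy'
      rw [abs_of_pos hy0] at hy'
      rw [abs_mul]
      calc |deriv (χ k) x| * |sinMap n x| ≤ C * (k + 1) * (L * (2 / (k + 1))) := by
            gcongr
            · exact hC k x
            · exact hy'.trans (by gcongr)
        _ = 2 * C * L := by field_simp
    rcases le_or_gt x (2 / (k + 1 : ℝ)) with hx1 | hx1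
    · exact hfin x hx.1 hx1 (hL x).1
    rcases le_or_gt (Real.pi - x) (2 / (k + 1 : ℝ)) with hx2 | hx2
    · exact hfin _ (sub_pos.2 hx.2) hx2 (hL x).2
    · rw [hz k x hx1 hx2, zero_mul, abs_zero]
      positivity
  have hb : Filter.Tendsto
      (fun k => ∫ x in Ioo (0 : ℝ) Real.pi, (deriv (χ k) x * sinMap n x) • q x)
      Filter.atTop (nhds 0) := by
    have : (0 : 𝕜) = ∫ x in Ioo (0 : ℝ) Real.pi, (0 : 𝕜) := by simp
    rw [this]
    refine tendsto_integral_of_dominated_convergence (fun x => 2 * C * L * ‖q x‖)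
      (fun k => (integrable_smul_L2 (((hχ k).continuous_deriv (by simp)).mul
        (sinMap n).continuous) q).aestronglyMeasurable)
      ((integrable_L2 q).norm.const_mul _) (fun k => ?_) ?_
    · filter_upwards [ae_restrict_mem measurableSet_Ioo] with x hx
      rw [norm_smul]
      exact mul_le_mul_of_nonneg_right (hpt k x hx) (norm_nonneg _)
    · filter_upwards [ae_restrict_mem measurableSet_Ioo] with x hx
      have ht := tendsto_two_div_add_one
      refine tendsto_const_nhds.congr' ?_
      filter_upwards [ht.eventually_lt_const hx.1, ht.eventually_lt_const (sub_pos.2 hx.2)]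
        with k hk1 hk2
      rw [hz k x hk1 hk2, zero_mul, zero_smul]
  have := h.integral_eq hχ hs h1 hlim (contDiff_sinMap n) hb
  simp only [hd, mul_smul] at this
  rw [integral_smul, ← cosC_eq_integral, ← sinC_eq_integral, RCLike.real_smul_eq_coe_mul] at this
  rw [eq_neg_iff_add_eq_zero, ← neg_eq_iff_add_eq_zero, ← this]
  simp

/-- The cosines do not vanish at the ends, so the boundary terms are killed by the continuous
representative of u: it is small in the layers, while slope times total width of the layers stays
bounded. -/
theorem HasWeakDeriv.cosC_eq {u v : L2 𝕜} (h : HasWeakDeriv u v) (h0 : VanishesAtEnds u) (n : ℕ) :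
    cosC n v = (n : 𝕜) * sinC n u := by
  obtain ⟨χ, C, hC0, hχ, hs, h1, hlim, hC, hz⟩ := exists_cutoff
  obtain ⟨g, hg, hug, hg0, hgπ⟩ := h0
  have hd : ∀ x, deriv (cosMap n) x = -(n * sinMap n x) := fun x => (hasDerivAt_cosMap n x).deriv
  have hpi := Real.pi_pos
  set w : ℝ → 𝕜 := fun x => cosMap n x • g x with hw
  have hwc : ContinuousOn w (Icc 0 Real.pi) := (cosMap n).continuous.continuousOn.smul hg
  have hsmall : ∀ ε > 0, ∃ δ > 0, ∀ x ∈ Ioo (0 : ℝ) Real.pi, x < δ ∨ Real.pi - x < δ →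
      ‖w x‖ ≤ ε := by
    intro ε hε
    obtain ⟨δ₁, hδ₁, H1⟩ := Metric.continuousWithinAt_iff.1 (hwc 0 ⟨le_rfl, hpi.le⟩) ε hε
    obtain ⟨δ₂, hδ₂, H2⟩ := Metric.continuousWithinAt_iff.1 (hwc Real.pi ⟨hpi.le, le_rfl⟩) ε hε
    refine ⟨min δ₁ δ₂, lt_min hδ₁ hδ₂, fun x hx hx' => ?_⟩
    rcases hx' with hx' | hx'
    · have := H1 (Ioo_subset_Icc_self hx) (by
        rw [Real.dist_eq, sub_zero, abs_of_pos hx.1]; exact hx'.trans_le (min_le_left _ _))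
      simpa [hw, hg0] using this.le
    · have := H2 (Ioo_subset_Icc_self hx) (by
        rw [Real.dist_eq, abs_sub_comm, abs_of_pos (sub_pos.2 hx.2)]
        exact hx'.trans_le (min_le_right _ _))
      simpa [hw, hgπ] using this.le
  have hb : Filter.Tendsto
      (fun k => ∫ x in Ioo (0 : ℝ) Real.pi, (deriv (χ k) x * cosMap n x) • u x)
      Filter.atTop (nhds 0) := by
    have heq : ∀ k, ∫ x in Ioo (0 : ℝ) Real.pi, (deriv (χ k) x * cosMap n x) • u x =
        ∫ x in Ioo (0 : ℝ) Real.pi, deriv (χ k) x • w x := by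
      intro k
      refine integral_congr_ae ?_
      filter_upwards [hug] with x hx
      rw [hx, mul_smul]
    simp only [heq]
    rw [Metric.tendsto_atTop]
    intro ε hε
    -- The slope bound C(k+1) times the total width 4/(k+1) is 4C; this choice leaves at most ε/2.
    obtain ⟨δ, hδ, Hδ⟩ := hsmall (ε / (4 * C + 1) / 2) (by positivity)
    have ht := tendsto_two_div_add_one
    obtain ⟨N, hN⟩ := Filter.eventually_atTop.1 (ht.eventually_lt_const hδ)
    refine ⟨N, fun k hk => ?_⟩
    have hk' := hN k hk
    have hkp : (0 : ℝ) < k + 1 := by positivity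
    rw [dist_zero_right]
    set S : Set ℝ := Ioo 0 Real.pi ∩
      (Icc 0 (2 / (k + 1 : ℝ)) ∪ Icc (Real.pi - 2 / (k + 1)) Real.pi) with hS
    have hrestr : ∫ x in Ioo (0 : ℝ) Real.pi, deriv (χ k) x • w x =
        ∫ x in S, deriv (χ k) x • w x := by
      refine setIntegral_eq_of_subset_of_forall_sdiff_eq_zero measurableSet_Ioo inter_subset_left
        fun x hx => ?_
      have hx1 : 2 / (k + 1 : ℝ) < x := by
        by_contra hcon
        exact hx.2 ⟨hx.1, Or.inl ⟨hx.1.1.le, not_lt.1 hcon⟩⟩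
      have hx2 : 2 / (k + 1 : ℝ) < Real.pi - x := by
        by_contra hcon
        exact hx.2 ⟨hx.1, Or.inr ⟨by linarith [not_lt.1 hcon], hx.1.2.le⟩⟩
      rw [hz k x hx1 hx2, zero_smul]
    have hvol : volume.real S ≤ 4 / (k + 1) := by
      calc volume.real S ≤
          volume.real (Icc 0 (2 / (k + 1 : ℝ)) ∪ Icc (Real.pi - 2 / (k + 1)) Real.pi) :=
            measureReal_mono inter_subset_right
              (measure_union_lt_top (by simp) (by simp)).ne
        _ ≤ volume.real (Icc 0 (2 / (k + 1 : ℝ))) +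
            volume.real (Icc (Real.pi - 2 / (k + 1 : ℝ)) Real.pi) := measureReal_union_le _ _
        _ = 4 / (k + 1) := by
            have : (0 : ℝ) ≤ 2 / (k + 1) := by positivity
            rw [Real.volume_real_Icc_of_le this, Real.volume_real_Icc_of_le (by linarith)]
            ring
    have hSfin : volume S < ⊤ :=
      (measure_mono inter_subset_left).trans_lt measure_Ioo_lt_top
    rw [hrestr]
    calc ‖∫ x in S, deriv (χ k) x • w x‖
        ≤ (C * (k + 1) * (ε / (4 * C + 1) / 2)) * volume.real S := by
          refine norm_setIntegral_le_of_norm_le_const hSfin fun x hx => ?_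
          rw [norm_smul]
          gcongr
          · exact hC k x
          · refine Hδ x hx.1 (hx.2.imp (fun h => h.2.trans_lt hk') fun h => ?_)
            linarith [h.1]
      _ ≤ (C * (k + 1) * (ε / (4 * C + 1) / 2)) * (4 / (k + 1)) := by gcongr
      _ = ε * (4 * C / (4 * C + 1) / 2) := by field_simp
      _ < ε := by
          have : 4 * C / (4 * C + 1) ≤ 1 := div_le_one_of_le₀ (by linarith) (by linarith)
          nlinarith
  have := h.integral_eq hχ hs h1 hlim (contDiff_cosMap n) hb
  simp only [hd, neg_smul, mul_smul] at this
  rw [integral_neg, neg_inj, integral_smul, ← cosC_eq_integral, ← sinC_eq_integral,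
    RCLike.real_smul_eq_coe_mul] at this
  rw [← this]
  simp

end TracesOfWeakDerivatives

/-! ### Control of a single mode, uniformly in the frequency. -/

section ModeControl

open Asymptotics

/-- A cutoff in time, equal to `1` near `0` and to `0` near `T`, with its first derivatives. -/
theorem exists_time_cutoff {T : ℝ} (hT : 0 < T) : ∃ (θ θ₁ θ₂ θ₃ : ℝ → ℝ) (M : ℝ),
    (∀ t, HasDerivAt θ (θ₁ t) t) ∧ (∀ t, HasDerivAt θ₁ (θ₂ t) t) ∧
    (∀ t, HasDerivAt θ₂ (θ₃ t) t) ∧ Continuous θ₃ ∧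
    (θ 0 = 1 ∧ θ₁ 0 = 0 ∧ θ₂ 0 = 0) ∧ (θ T = 0 ∧ θ₁ T = 0 ∧ θ₂ T = 0) ∧
    ∀ t, |θ t| ≤ M ∧ |θ₁ t| ≤ M ∧ |θ₂ t| ≤ M ∧ |θ₃ t| ≤ M := by
  set φ : ContDiffBump (0 : ℝ) := ⟨T / 3, 2 * T / 3, by positivity, by linarith⟩ with hφ
  set θ : ℝ → ℝ := fun t => φ t with hθ
  have h0 : ContDiff ℝ ∞ θ := φ.contDiff
  have h1 : ContDiff ℝ ∞ (deriv θ) := (contDiff_infty_iff_deriv.1 h0).2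
  have h2 : ContDiff ℝ ∞ (deriv (deriv θ)) := (contDiff_infty_iff_deriv.1 h1).2
  have h3 : ContDiff ℝ ∞ (deriv (deriv (deriv θ))) := (contDiff_infty_iff_deriv.1 h2).2
  have c0 : HasCompactSupport θ := φ.hasCompactSupport
  obtain ⟨M0, hM0⟩ := c0.exists_bound_of_continuous h0.continuous
  obtain ⟨M1, hM1⟩ := c0.deriv.exists_bound_of_continuous h1.continuous
  obtain ⟨M2, hM2⟩ := c0.deriv.deriv.exists_bound_of_continuous h2.continuous
  obtain ⟨M3, hM3⟩ := c0.deriv.deriv.deriv.exists_bound_of_continuous h3.continuous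
  have e0 : θ =ᶠ[nhds 0] fun _ => 1 := φ.eventuallyEq_one
  have eT : θ =ᶠ[nhds T] fun _ => 0 := by
    filter_upwards [Ioi_mem_nhds (show 2 * T / 3 < T by linarith)] with t ht
    have ht' : 2 * T / 3 < t := ht
    refine φ.zero_of_le_dist ?_
    rw [Real.dist_eq, sub_zero]
    exact ht'.le.trans (le_abs_self t)
  have e01 : deriv θ =ᶠ[nhds 0] fun _ => 0 := by simpa using e0.deriv
  have eT1 : deriv θ =ᶠ[nhds T] fun _ => 0 := by simpa using eT.deriv
  have e02 : deriv (deriv θ) =ᶠ[nhds 0] fun _ => 0 := by simpa using e01.deriv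
  have eT2 : deriv (deriv θ) =ᶠ[nhds T] fun _ => 0 := by simpa using eT1.deriv
  refine ⟨θ, deriv θ, deriv (deriv θ), deriv (deriv (deriv θ)), max (max M0 M1) (max M2 M3),
    fun t => (h0.differentiable (by simp) t).hasDerivAt,
    fun t => (h1.differentiable (by simp) t).hasDerivAt,
    fun t => (h2.differentiable (by simp) t).hasDerivAt, h3.continuous,
    ⟨e0.self_of_nhds, e01.self_of_nhds, e02.self_of_nhds⟩,
    ⟨eT.self_of_nhds, eT1.self_of_nhds, eT2.self_of_nhds⟩, fun t =>
    ⟨(hM0 t).trans ?_, (hM1 t).trans ?_, (hM2 t).trans ?_, (hM3 t).trans ?_⟩⟩ <;> simp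

variable {𝕜 : Type*} [RCLike 𝕜]

theorem hasDerivAt_ofReal_comp {θ : ℝ → ℝ} {θ' t : ℝ} (h : HasDerivAt θ θ' t) :
    HasDerivAt (fun s => (θ s : 𝕜)) (θ' : 𝕜) t :=
  (RCLike.ofRealCLM (K := 𝕜)).hasFDerivAt.comp_hasDerivAt t h

/-- Null controllability of the modes: `p` is the flat output, `u` the velocity, and `r` the
component on which the control `f` acts. The bounds do not depend on the mode. -/
theorem exists_mode_control (𝕜 : Type*) [RCLike 𝕜] {lam α β G ν E : ℝ} (hα : α ≠ 0) (hβ : β ≠ 0)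
    (hneg : α * G + β * E < 0) {T : ℝ} (hT : 0 < T) :
    ∃ K : ℝ, 0 ≤ K ∧ ∀ (n : ℕ) (p₀ u₀ r₀ : 𝕜), (n = 0 → p₀ = 0 ∧ u₀ = 0) →
      ∃ p u r f : ℝ → 𝕜, Continuous f ∧
        (∀ t, HasDerivAt p (-(lam : 𝕜) * p t + (α : 𝕜) * ((n : 𝕜) * u t)) t) ∧
        (∀ t, HasDerivAt u ((n : 𝕜) * ((β : 𝕜) * r t + (G : 𝕜) * p t)) t) ∧
        (∀ t, HasDerivAt r (-(ν : 𝕜) * r t + (E : 𝕜) * ((n : 𝕜) * u t) + f t) t) ∧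
        (p 0 = p₀ ∧ u 0 = u₀ ∧ r 0 = r₀) ∧ (p T = 0 ∧ u T = 0 ∧ r T = 0) ∧
        (∀ t, ‖p t‖ ≤ K * (‖p₀‖ + ‖u₀‖ + ‖r₀‖) ∧ ‖u t‖ ≤ K * (‖p₀‖ + ‖u₀‖ + ‖r₀‖) ∧
          ‖r t‖ ≤ K * (‖p₀‖ + ‖u₀‖ + ‖r₀‖) ∧ ‖f t‖ ≤ K * (‖p₀‖ + ‖u₀‖ + ‖r₀‖)) ∧
        (n = 0 → ∀ t, p t = 0 ∧ u t = 0) := by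
  obtain ⟨θ, θ₁, θ₂, θ₃, M, hθ, hθ₁, hθ₂, hθ₃, ⟨h00, h01, h02⟩, ⟨hT0, hT1, hT2⟩, hM⟩ :=
    exists_time_cutoff hT
  -- Without damping and control the mode oscillates at frequency w n; the sign hypothesis makes w
  -- real.
  obtain ⟨w, hw0, hw2⟩ : ∃ w : ℝ, w ≠ 0 ∧ w ^ 2 = -(α * G + β * E) :=
    ⟨√(-(α * G + β * E)), (Real.sqrt_pos.2 (by linarith)).ne', Real.sq_sqrt (by linarith)⟩
  -- the data of a mode at some time
  let X := ℕ × (𝕜 × 𝕜 × 𝕜) × ℝ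
  let N : X → ℝ := fun x => ‖x.2.1.1‖ + ‖x.2.1.2.1‖ + ‖x.2.1.2.2‖
  let ι : X → 𝕜 := fun x => (x.1 : 𝕜)⁻¹
  -- As θ is flat at 0, the initial values of u and r fix g'(0)/n = w c1 and g''(0)/n² = -w² c0; the
  -- constant part of g then adjusts g(0) to p₀.
  let c1 : X → 𝕜 := fun x => (w : 𝕜)⁻¹ * ((α : 𝕜) * x.2.1.2.1 - (lam : 𝕜) * (ι x * x.2.1.1))
  let c0 : X → 𝕜 := fun x => -((w : 𝕜) ^ 2)⁻¹ * (-(lam : 𝕜) * (ι x * ((w : 𝕜) * c1 x)) +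
    (α : 𝕜) * ((β : 𝕜) * x.2.1.2.2 + (G : 𝕜) * x.2.1.1))
  let co : X → 𝕜 := fun x => ((Real.cos (w * x.1 * x.2.2) : ℝ) : 𝕜)
  let si : X → 𝕜 := fun x => ((Real.sin (w * x.1 * x.2.2) : ℝ) : 𝕜)
  let Θ : X → 𝕜 := fun x => (θ x.2.2 : 𝕜)
  let Θ₁ : X → 𝕜 := fun x => (θ₁ x.2.2 : 𝕜)
  let Θ₂ : X → 𝕜 := fun x => (θ₂ x.2.2 : 𝕜)
  let Θ₃ : X → 𝕜 := fun x => (θ₃ x.2.2 : 𝕜)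
  let g : X → 𝕜 := fun x => (x.2.1.1 - c0 x) + co x * c0 x + si x * c1 x
  -- g₁ = g'/n and g₂ = g''/n² are free of powers of n.
  let g₁ : X → 𝕜 := fun x => (w : 𝕜) * (co x * c1 x - si x * c0 x)
  let g₂ : X → 𝕜 := fun x => -(w : 𝕜) ^ 2 * (co x * c0 x + si x * c1 x)
  let p : X → 𝕜 := fun x => Θ x * g x
  -- For n ≥ 1, u solves the first equation, q is p''/n², and r solves the second. f solves the
  -- third after the terms n θ g₁ from p'''/n², p' and n u have cancelled, so only nonpositive
  -- powers of n remain.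
  let u : X → 𝕜 := fun x => (α : 𝕜)⁻¹ *
    (ι x * (Θ₁ x * g x) + (lam : 𝕜) * (ι x * (Θ x * g x)) + Θ x * g₁ x)
  let q : X → 𝕜 := fun x => ι x * (ι x * (Θ₂ x * g x)) + 2 * (ι x * (Θ₁ x * g₁ x)) + Θ x * g₂ x
  let r : X → 𝕜 := fun x => ((α : 𝕜) * (β : 𝕜))⁻¹ * (q x +
      (lam : 𝕜) * (ι x * (ι x * (Θ₁ x * g x)) + ι x * (Θ x * g₁ x))) -
      (G : 𝕜) * (β : 𝕜)⁻¹ * (Θ x * g x)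
  let f : X → 𝕜 := fun x => ((α : 𝕜) * (β : 𝕜))⁻¹ * (ι x * (ι x * (Θ₃ x * g x)) +
      3 * (ι x * (Θ₂ x * g₁ x)) + 3 * (Θ₁ x * g₂ x) + (lam : 𝕜) * q x) -
      (G : 𝕜) * (β : 𝕜)⁻¹ * (Θ₁ x * g x) -
      (E : 𝕜) * (α : 𝕜)⁻¹ * (Θ₁ x * g x + (lam : 𝕜) * (Θ x * g x)) + (ν : 𝕜) * r x
  -- Along the filter `⊤`, big O is a bound at every point of X with one constant, hence uniform in
  -- the mode, the data and the time.
  have hbound : p =O[⊤] N ∧ u =O[⊤] N ∧ r =O[⊤] N ∧ f =O[⊤] N := by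
    have hbdd : ∀ {h F : X → 𝕜}, h =O[⊤] (fun _ => (1 : ℝ)) → F =O[⊤] N →
        (fun x => h x * F x) =O[⊤] N := fun h1 h2 => by simpa using h1.mul h2
    have hN1 : (fun x : X => x.2.1.1) =O[⊤] N := IsBigO.of_bound 1 (Filter.Eventually.of_forall
      fun x => by
        rw [Real.norm_of_nonneg (by positivity), one_mul]
        simp only [N]
        linarith [norm_nonneg x.2.1.2.1, norm_nonneg x.2.1.2.2])
    have hN2 : (fun x : X => x.2.1.2.1) =O[⊤] N := IsBigO.of_bound 1 (Filter.Eventually.of_forall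
      fun x => by
        rw [Real.norm_of_nonneg (by positivity), one_mul]
        simp only [N]
        linarith [norm_nonneg x.2.1.1, norm_nonneg x.2.1.2.2])
    have hN3 : (fun x : X => x.2.1.2.2) =O[⊤] N := IsBigO.of_bound 1 (Filter.Eventually.of_forall
      fun x => by
        rw [Real.norm_of_nonneg (by positivity), one_mul]
        simp only [N]
        linarith [norm_nonneg x.2.1.1, norm_nonneg x.2.1.2.1])
    have hreal : ∀ (h : X → ℝ) (C : ℝ), (∀ x, |h x| ≤ C) →
        (fun x => (h x : 𝕜)) =O[⊤] (fun _ => (1 : ℝ)) := fun h C hC =>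
      IsBigO.of_bound C (Filter.Eventually.of_forall fun x => by simpa using hC x)
    -- The bound includes n = 0, where the inverse is 0 by convention.
    have hι : ι =O[⊤] (fun _ => (1 : ℝ)) :=
      IsBigO.of_bound 1 (Filter.Eventually.of_forall fun x => by
        simp only [ι, norm_inv, RCLike.norm_natCast, norm_one, mul_one]
        exact Nat.cast_inv_le_one _)
    have hco : co =O[⊤] (fun _ => (1 : ℝ)) := hreal _ 1 fun x => Real.abs_cos_le_one _
    have hsi : si =O[⊤] (fun _ => (1 : ℝ)) := hreal _ 1 fun x => Real.abs_sin_le_one _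
    have hΘ : Θ =O[⊤] (fun _ => (1 : ℝ)) := hreal _ M fun x => (hM _).1
    have hΘ₁ : Θ₁ =O[⊤] (fun _ => (1 : ℝ)) := hreal _ M fun x => (hM _).2.1
    have hΘ₂ : Θ₂ =O[⊤] (fun _ => (1 : ℝ)) := hreal _ M fun x => (hM _).2.2.1
    have hΘ₃ : Θ₃ =O[⊤] (fun _ => (1 : ℝ)) := hreal _ M fun x => (hM _).2.2.2
    have hc1 : c1 =O[⊤] N :=
      ((hN2.const_mul_left _).sub ((hbdd hι hN1).const_mul_left _)).const_mul_left _
    have hc0 : c0 =O[⊤] N :=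
      (((hbdd hι (hc1.const_mul_left _)).const_mul_left _).add
        (((hN3.const_mul_left _).add (hN1.const_mul_left _)).const_mul_left _)).const_mul_left _
    have hg : g =O[⊤] N := ((hN1.sub hc0).add (hbdd hco hc0)).add (hbdd hsi hc1)
    have hg₁ : g₁ =O[⊤] N := ((hbdd hco hc1).sub (hbdd hsi hc0)).const_mul_left _
    have hg₂ : g₂ =O[⊤] N := ((hbdd hco hc0).add (hbdd hsi hc1)).const_mul_left _
    have hp : p =O[⊤] N := hbdd hΘ hg
    have hu : u =O[⊤] N := (((hbdd hι (hbdd hΘ₁ hg)).add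
      ((hbdd hι (hbdd hΘ hg)).const_mul_left _)).add (hbdd hΘ hg₁)).const_mul_left _
    have hq : q =O[⊤] N := ((hbdd hι (hbdd hι (hbdd hΘ₂ hg))).add
      ((hbdd hι (hbdd hΘ₁ hg₁)).const_mul_left _)).add (hbdd hΘ hg₂)
    have hr : r =O[⊤] N := ((hq.add (((hbdd hι (hbdd hι (hbdd hΘ₁ hg))).add
      (hbdd hι (hbdd hΘ hg₁))).const_mul_left _)).const_mul_left _).sub
      ((hbdd hΘ hg).const_mul_left _)
    have hf : f =O[⊤] N := (((((((hbdd hι (hbdd hι (hbdd hΘ₃ hg))).add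
      ((hbdd hι (hbdd hΘ₂ hg₁)).const_mul_left _)).add ((hbdd hΘ₁ hg₂).const_mul_left _)).add
      (hq.const_mul_left _)).const_mul_left _).sub ((hbdd hΘ₁ hg).const_mul_left _)).sub
      (((hbdd hΘ₁ hg).add ((hbdd hΘ hg).const_mul_left _)).const_mul_left _)).add
      (hr.const_mul_left _)
    exact ⟨hp, hu, hr, hf⟩
  obtain ⟨bp, bu, br, bf⟩ := hbound
  obtain ⟨Kp, hKp⟩ := Asymptotics.isBigO_top.1 bp
  obtain ⟨Ku, hKu⟩ := Asymptotics.isBigO_top.1 bu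
  obtain ⟨Kr, hKr⟩ := Asymptotics.isBigO_top.1 br
  obtain ⟨Kf, hKf⟩ := Asymptotics.isBigO_top.1 bf
  set K₀ : ℝ := max (max Kp Ku) (max Kr Kf) with hK₀
  -- The last entry serves the mode n = 0, which is treated separately.
  set K : ℝ := max (max 0 K₀) ((1 + |ν|) * M) with hK
  refine ⟨K, (le_max_left _ _).trans (le_max_left _ _), fun n p₀ u₀ r₀ hn0 => ?_⟩
  have hθc : Continuous θ := continuous_iff_continuousAt.2 fun t => (hθ t).continuousAt
  have hθ₁c : Continuous θ₁ := continuous_iff_continuousAt.2 fun t => (hθ₁ t).continuousAt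
  have hθ₂c : Continuous θ₂ := continuous_iff_continuousAt.2 fun t => (hθ₂ t).continuousAt
  have hcast : Continuous (fun x : ℝ => (x : 𝕜)) := RCLike.continuous_ofReal
  -- For n = 0 only r is present, and r = θ r₀ is imposed.
  rcases eq_or_ne n 0 with rfl | hn
  · obtain ⟨rfl, rfl⟩ := hn0 rfl
    have hM0 : 0 ≤ M := (abs_nonneg _).trans (hM 0).1
    have hKM : M ≤ K := le_trans (by nlinarith [abs_nonneg ν]) (le_max_right _ _)
    have hK0 : 0 ≤ K := hM0.trans hKM
    refine ⟨fun _ => 0, fun _ => 0, fun t => (θ t : 𝕜) * r₀,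
      fun t => ((θ₁ t : 𝕜) + (ν : 𝕜) * (θ t : 𝕜)) * r₀, by fun_prop, fun t => ?_, fun t => ?_,
      fun t => ?_, ⟨rfl, rfl, by simp [h00]⟩, ⟨rfl, rfl, by simp [hT0]⟩,
      fun t => ⟨?_, ?_, ?_, ?_⟩, fun _ t => ⟨rfl, rfl⟩⟩
    · simpa using hasDerivAt_const t (0 : 𝕜)
    · simpa using hasDerivAt_const t (0 : 𝕜)
    · refine ((hasDerivAt_ofReal_comp (hθ t)).mul_const r₀).congr_deriv ?_
      push_cast; ring
    · simpa using mul_nonneg hK0 (norm_nonneg r₀)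
    · simpa using mul_nonneg hK0 (norm_nonneg r₀)
    · simp only [norm_mul, norm_zero, zero_add, RCLike.norm_ofReal]
      exact mul_le_mul_of_nonneg_right ((hM t).1.trans hKM) (norm_nonneg _)
    · simp only [norm_mul, norm_zero, zero_add]
      refine mul_le_mul_of_nonneg_right (le_trans ?_ (le_max_right _ _)) (norm_nonneg _)
      refine (norm_add_le _ _).trans ?_
      rw [norm_mul]
      simp only [RCLike.norm_ofReal]
      have := mul_le_mul_of_nonneg_left (hM t).1 (abs_nonneg ν)
      linarith [(hM t).2.1]
  have hnk : (n : 𝕜) ≠ 0 := by exact_mod_cast hn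
  have hαk : (α : 𝕜) ≠ 0 := by exact_mod_cast hα
  have hβk : (β : 𝕜) ≠ 0 := by exact_mod_cast hβ
  have hwk : (w : 𝕜) ≠ 0 := by exact_mod_cast hw0
  have hw2k : (w : 𝕜) ^ 2 = -((α : 𝕜) * (G : 𝕜) + (β : 𝕜) * (E : 𝕜)) := by exact_mod_cast hw2
  let x : ℝ → X := fun t => (n, (p₀, u₀, r₀), t)
  have dc0 : ∀ t, c0 (x t) = c0 (x 0) := fun t => rfl
  have dc1 : ∀ t, c1 (x t) = c1 (x 0) := fun t => rfl
  have dco : ∀ t, HasDerivAt (fun s => co (x s)) (-((w : 𝕜) * (n : 𝕜)) * si (x t)) t := by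
    intro t
    have : HasDerivAt (fun s : ℝ => Real.cos (w * n * s)) (-Real.sin (w * n * t) * (w * n * 1)) t :=
      ((hasDerivAt_id t).const_mul (w * n)).cos
    refine (hasDerivAt_ofReal_comp this).congr_deriv ?_
    simp only [si, x]
    push_cast; ring
  have dsi : ∀ t, HasDerivAt (fun s => si (x s)) (((w : 𝕜) * (n : 𝕜)) * co (x t)) t := by
    intro t
    have : HasDerivAt (fun s : ℝ => Real.sin (w * n * s)) (Real.cos (w * n * t) * (w * n * 1)) t :=
      ((hasDerivAt_id t).const_mul (w * n)).sin
    refine (hasDerivAt_ofReal_comp this).congr_deriv ?_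
    simp only [co, x]
    push_cast; ring
  have dg : ∀ t, HasDerivAt (fun s => g (x s)) ((n : 𝕜) * g₁ (x t)) t := by
    intro t
    refine ((((dco t).mul_const (c0 (x 0))).const_add (p₀ - c0 (x 0))).add
      ((dsi t).mul_const (c1 (x 0)))).congr_deriv ?_
    simp only [g₁]
    rw [dc0 t, dc1 t]; ring
  have dg₁ : ∀ t, HasDerivAt (fun s => g₁ (x s)) ((n : 𝕜) * g₂ (x t)) t := by
    intro t
    refine ((((dco t).mul_const (c1 (x 0))).sub
      ((dsi t).mul_const (c0 (x 0)))).const_mul (w : 𝕜)).congr_deriv ?_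
    simp only [g₂]
    rw [dc0 t, dc1 t]; ring
  have dg₂ : ∀ t, HasDerivAt (fun s => g₂ (x s)) (-(w : 𝕜) ^ 2 * ((n : 𝕜) * g₁ (x t))) t := by
    intro t
    refine ((((dco t).mul_const (c0 (x 0))).add
      ((dsi t).mul_const (c1 (x 0)))).const_mul (-(w : 𝕜) ^ 2)).congr_deriv ?_
    simp only [g₁]
    rw [dc0 t, dc1 t]; ring
  have dΘ : ∀ t, HasDerivAt (fun s => Θ (x s)) (Θ₁ (x t)) t :=
    fun t => hasDerivAt_ofReal_comp (hθ t)
  have dΘ₁ : ∀ t, HasDerivAt (fun s => Θ₁ (x s)) (Θ₂ (x t)) t :=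
    fun t => hasDerivAt_ofReal_comp (hθ₁ t)
  have dΘ₂ : ∀ t, HasDerivAt (fun s => Θ₂ (x s)) (Θ₃ (x t)) t :=
    fun t => hasDerivAt_ofReal_comp (hθ₂ t)
  have hιx : ∀ t, ι (x t) = (n : 𝕜)⁻¹ := fun t => rfl
  have dp : ∀ t, HasDerivAt (fun s => p (x s))
      (-(lam : 𝕜) * p (x t) + (α : 𝕜) * ((n : 𝕜) * u (x t))) t := by
    intro t
    refine ((dΘ t).mul (dg t)).congr_deriv ?_
    simp only [p, u, hιx]
    field_simp; ring
  have du : ∀ t, HasDerivAt (fun s => u (x s))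
      ((n : 𝕜) * ((β : 𝕜) * r (x t) + (G : 𝕜) * p (x t))) t := by
    intro t
    refine ((((((dΘ₁ t).mul (dg t)).const_mul (n : 𝕜)⁻¹).add
      ((((dΘ t).mul (dg t)).const_mul (n : 𝕜)⁻¹).const_mul (lam : 𝕜))).add
      ((dΘ t).mul (dg₁ t))).const_mul (α : 𝕜)⁻¹).congr_deriv ?_
    simp only [p, r, q, hιx]
    field_simp; ring
  have dq : ∀ t, HasDerivAt (fun s => q (x s)) ((n : 𝕜)⁻¹ * ((n : 𝕜)⁻¹ * (Θ₃ (x t) * g (x t))) +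
      3 * ((n : 𝕜)⁻¹ * (Θ₂ (x t) * g₁ (x t))) + 3 * (Θ₁ (x t) * g₂ (x t)) -
      (w : 𝕜) ^ 2 * ((n : 𝕜) * (Θ (x t) * g₁ (x t)))) t := by
    intro t
    refine ((((((dΘ₂ t).mul (dg t)).const_mul (n : 𝕜)⁻¹).const_mul (n : 𝕜)⁻¹).add
      ((((dΘ₁ t).mul (dg₁ t)).const_mul (n : 𝕜)⁻¹).const_mul (2 : 𝕜))).add
      ((dΘ t).mul (dg₂ t))).congr_deriv ?_
    field_simp; ring
  have dr : ∀ t, HasDerivAt (fun s => r (x s))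
      (-(ν : 𝕜) * r (x t) + (E : 𝕜) * ((n : 𝕜) * u (x t)) + f (x t)) t := by
    intro t
    refine ((((dq t).add ((((((dΘ₁ t).mul (dg t)).const_mul (n : 𝕜)⁻¹).const_mul (n : 𝕜)⁻¹).add
      (((dΘ t).mul (dg₁ t)).const_mul (n : 𝕜)⁻¹)).const_mul (lam : 𝕜))).const_mul
      ((α : 𝕜) * (β : 𝕜))⁻¹).sub
      (((dΘ t).mul (dg t)).const_mul ((G : 𝕜) * (β : 𝕜)⁻¹))).congr_deriv ?_
    -- Substituting w² = -(αG + βE) is what makes the terms of order n cancel.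
    simp only [u, f, q, hιx, hw2k]
    field_simp; ring
  have hcont : ∀ {h : ℝ → 𝕜} {h' : ℝ → 𝕜}, (∀ t, HasDerivAt h (h' t) t) → Continuous h :=
    fun H => continuous_iff_continuousAt.2 fun t => (H t).continuousAt
  have hΘ₃c : Continuous (fun s => Θ₃ (x s)) := hcast.comp hθ₃
  have fc : Continuous (fun t => f (x t)) := by
    have cg := hcont dg
    have cg₁ := hcont dg₁
    have cg₂ := hcont dg₂
    have cΘ := hcont dΘ
    have cΘ₁ := hcont dΘ₁
    have cΘ₂ := hcont dΘ₂
    have cq := hcont dq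
    have cr := hcont dr
    have hgen : ∀ a₀ a₁ a₂ a₃ b₀ b₁ b₂ c d : ℝ → 𝕜, Continuous a₀ → Continuous a₁ →
        Continuous a₂ → Continuous a₃ → Continuous b₀ → Continuous b₁ → Continuous b₂ →
        Continuous c → Continuous d → Continuous fun t =>
          ((α : 𝕜) * (β : 𝕜))⁻¹ * ((n : 𝕜)⁻¹ * ((n : 𝕜)⁻¹ * (a₃ t * b₀ t)) +
            3 * ((n : 𝕜)⁻¹ * (a₂ t * b₁ t)) + 3 * (a₁ t * b₂ t) + (lam : 𝕜) * c t) -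
            (G : 𝕜) * (β : 𝕜)⁻¹ * (a₁ t * b₀ t) -
            (E : 𝕜) * (α : 𝕜)⁻¹ * (a₁ t * b₀ t + (lam : 𝕜) * (a₀ t * b₀ t)) + (ν : 𝕜) * d t := by
      intros
      fun_prop
    exact hgen _ _ _ _ _ _ _ _ _ cΘ cΘ₁ cΘ₂ hΘ₃c cg cg₁ cg₂ cq cr
  have hco0 : co (x 0) = 1 := by simp [co, x]
  have hsi0 : si (x 0) = 0 := by simp [si, x]
  have hΘ0 : Θ (x 0) = 1 := by simp [Θ, x, h00]
  have hΘ₁0 : Θ₁ (x 0) = 0 := by simp [Θ₁, x, h01]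
  have hΘ₂0 : Θ₂ (x 0) = 0 := by simp [Θ₂, x, h02]
  have hΘT : Θ (x T) = 0 := by simp [Θ, x, hT0]
  have hΘ₁T : Θ₁ (x T) = 0 := by simp [Θ₁, x, hT1]
  have hΘ₂T : Θ₂ (x T) = 0 := by simp [Θ₂, x, hT2]
  have hc1v : c1 (x 0) = (w : 𝕜)⁻¹ * ((α : 𝕜) * u₀ - (lam : 𝕜) * ((n : 𝕜)⁻¹ * p₀)) := rfl
  have hc0v : c0 (x 0) = -((w : 𝕜) ^ 2)⁻¹ * (-(lam : 𝕜) * ((n : 𝕜)⁻¹ * ((w : 𝕜) * c1 (x 0))) +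
    (α : 𝕜) * ((β : 𝕜) * r₀ + (G : 𝕜) * p₀)) := rfl
  have hgv : g (x 0) = p₀ := by
    simp only [g, hco0, hsi0]
    simp only [x]; ring
  have hg₁v : g₁ (x 0) = (α : 𝕜) * u₀ - (lam : 𝕜) * ((n : 𝕜)⁻¹ * p₀) := by
    simp only [g₁, hco0, hsi0, hc1v]
    field_simp; ring
  have hg₂v : g₂ (x 0) = -(lam : 𝕜) * ((n : 𝕜)⁻¹ * g₁ (x 0)) +
      (α : 𝕜) * ((β : 𝕜) * r₀ + (G : 𝕜) * p₀) := by
    simp only [g₁, g₂, hco0, hsi0, hc0v]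
    field_simp; ring
  have hNx : ∀ t, N (x t) = ‖p₀‖ + ‖u₀‖ + ‖r₀‖ := fun t => rfl
  have hfin : ∀ {C : ℝ} {h : X → 𝕜} (_ : ∀ y, ‖h y‖ ≤ C * ‖N y‖) (_ : C ≤ K₀) (t : ℝ),
      ‖h (x t)‖ ≤ K * (‖p₀‖ + ‖u₀‖ + ‖r₀‖) := by
    intro C h H hC t
    refine (H (x t)).trans ?_
    rw [hNx, Real.norm_of_nonneg (by positivity)]
    exact mul_le_mul_of_nonneg_right
      (hC.trans ((le_max_right _ _).trans (le_max_left _ _))) (by positivity)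
  refine ⟨fun t => p (x t), fun t => u (x t), fun t => r (x t), fun t => f (x t), fc, dp, du, dr,
    ⟨?_, ?_, ?_⟩, ⟨?_, ?_, ?_⟩, fun t => ⟨hfin hKp (by simp [hK₀]) t, hfin hKu (by simp [hK₀]) t,
      hfin hKr (by simp [hK₀]) t, hfin hKf (by simp [hK₀]) t⟩, fun h => absurd h hn⟩
  · simp only [p, hΘ0, hgv, one_mul]
  · simp only [u, hΘ0, hΘ₁0, hgv, hg₁v, hιx]
    field_simp; ring
  · simp only [r, q, hΘ0, hΘ₁0, hΘ₂0, hgv, hg₂v, hιx]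
    field_simp; ring
  · simp only [p, hΘT, zero_mul]
  · simp only [u, hΘT, hΘ₁T, zero_mul, mul_zero, add_zero]
  · simp only [r, q, hΘT, hΘ₁T, hΘ₂T, zero_mul, mul_zero, add_zero, sub_zero]

end ModeControl

/-! ### Null control in L²(0,π), assembled from the modes. -/

section Solutions

variable {𝕜 : Type*} [RCLike 𝕜]

/-- Null controllability, in `L²(0,π)`, of the system of the modes. -/
theorem exists_null_control {lam α β G ν E : ℝ} (hα : α ≠ 0) (hβ : β ≠ 0)
    (hneg : α * G + β * E < 0) {T : ℝ} (hT : 0 < T) (P₀ U₀ R₀ : L2 𝕜) (hP₀ : P₀ ∈ L2m 𝕜) :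
    ∃ P U R f : ℝ → L2 𝕜, Continuous P ∧ Continuous U ∧ Continuous R ∧ Continuous f ∧
      (P T = 0 ∧ U T = 0 ∧ R T = 0) ∧ (∀ t, P t ∈ L2m 𝕜) ∧
      ∀ t, ∃ dU : L2 𝕜, HasWeakDeriv (∫ s in (0 : ℝ)..t, U s) dU ∧
        VanishesAtEnds (∫ s in (0 : ℝ)..t, U s) ∧
        HasWeakDeriv (-(β • (∫ s in (0 : ℝ)..t, R s) + G • ∫ s in (0 : ℝ)..t, P s)) (U t - U₀) ∧
        P t - P₀ = -lam • (∫ s in (0 : ℝ)..t, P s) + α • dU ∧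
        R t - R₀ - (∫ s in (0 : ℝ)..t, f s) = -ν • (∫ s in (0 : ℝ)..t, R s) + E • dU := by
  obtain ⟨K, hK, H⟩ := exists_mode_control 𝕜 (lam := lam) (ν := ν) hα hβ hneg hT
  choose p u r f hfc hp hu hr h0 hT' hb hz using fun n =>
    H n (cosC n P₀) (sinC n U₀) (cosC n R₀) (by
      rintro rfl
      exact ⟨(mem_L2m_iff _).1 hP₀, sinC_zero _⟩)
  have hcont : ∀ {h h' : ℝ → 𝕜}, (∀ t, HasDerivAt h (h' t) t) → Continuous h :=
    fun H => continuous_iff_continuousAt.2 fun t => (H t).continuousAt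
  set d : ℕ → ℝ := fun n => K * (‖cosC n P₀‖ + ‖sinC n U₀‖ + ‖cosC n R₀‖) with hd
  -- Uses (x + y + z)² ≤ 3 (x² + y² + z²).
  have hds : Summable fun n => d n ^ 2 := by
    refine Summable.of_nonneg_of_le (fun n => sq_nonneg _) (fun n => ?_)
      ((((summable_cosC_sq P₀).add (summable_sinC_sq U₀)).add (summable_cosC_sq R₀)).mul_left
        (3 * K ^ 2))
    simp only [hd]
    rw [mul_pow, mul_comm (3 : ℝ), mul_assoc]
    refine mul_le_mul_of_nonneg_left ?_ (sq_nonneg K)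
    generalize ‖cosC n P₀‖ = x
    generalize ‖sinC n U₀‖ = y
    generalize ‖cosC n R₀‖ = z
    linarith [sq_nonneg (x - y), sq_nonneg (x - z), sq_nonneg (y - z)]
  obtain ⟨P, hPc, hP⟩ := exists_continuous_cosC (fun n => hcont (hp n)) hds fun n t => (hb n t).1
  obtain ⟨U, hUc, hU⟩ := exists_continuous_sinC (fun t => (hz 0 rfl t).2)
    (fun n => hcont (hu n)) hds fun n t => (hb n t).2.1
  obtain ⟨R, hRc, hR⟩ :=
    exists_continuous_cosC (fun n => hcont (hr n)) hds fun n t => (hb n t).2.2.1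
  obtain ⟨F, hFc, hF⟩ := exists_continuous_cosC hfc hds fun n t => (hb n t).2.2.2
  refine ⟨P, U, R, F, hPc, hUc, hRc, hFc,
    ⟨cosC_ext fun n => ?_, sinC_ext fun n => ?_, cosC_ext fun n => ?_⟩, fun t => ?_, fun t => ?_⟩
  · rw [hP, (hT' n).1, map_zero]
  · rw [hU, (hT' n).2.1, map_zero]
  · rw [hR, (hT' n).2.2, map_zero]
  · rw [mem_L2m_iff, hP, (hz 0 rfl t).1]
  have iP : ∀ n, cosC n (∫ s in (0 : ℝ)..t, P s) = ∫ s in (0 : ℝ)..t, p n s := fun n => by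
    rw [← ContinuousLinearMap.intervalIntegral_comp_comm _ (hPc.intervalIntegrable _ _)]
    simp only [hP]
  have iU : ∀ n, sinC n (∫ s in (0 : ℝ)..t, U s) = ∫ s in (0 : ℝ)..t, u n s := fun n => by
    rw [← ContinuousLinearMap.intervalIntegral_comp_comm _ (hUc.intervalIntegrable _ _)]
    simp only [hU]
  have iR : ∀ n, cosC n (∫ s in (0 : ℝ)..t, R s) = ∫ s in (0 : ℝ)..t, r n s := fun n => by
    rw [← ContinuousLinearMap.intervalIntegral_comp_comm _ (hRc.intervalIntegrable _ _)]
    simp only [hR]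
  have iF : ∀ n, cosC n (∫ s in (0 : ℝ)..t, F s) = ∫ s in (0 : ℝ)..t, f n s := fun n => by
    rw [← ContinuousLinearMap.intervalIntegral_comp_comm _ (hFc.intervalIntegrable _ _)]
    simp only [hF]
  have ii : ∀ {h : ℝ → 𝕜}, Continuous h → IntervalIntegrable h volume 0 t :=
    fun h => h.intervalIntegrable _ _
  have ep : ∀ n, cosC n (P t - P₀) = -(lam : 𝕜) * (∫ s in (0 : ℝ)..t, p n s) +
      (α : 𝕜) * ((n : 𝕜) * ∫ s in (0 : ℝ)..t, u n s) := by
    intro n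
    have cp := hcont (hp n)
    have cu := hcont (hu n)
    rw [map_sub, hP, ← (h0 n).1,
      ← intervalIntegral.integral_eq_sub_of_hasDerivAt (fun s _ => hp n s) (ii (by fun_prop)),
      intervalIntegral.integral_add (ii (by fun_prop)) (ii (by fun_prop))]
    simp only [intervalIntegral.integral_const_mul]
  have eu : ∀ n, sinC n (U t - U₀) = (n : 𝕜) * ((β : 𝕜) * (∫ s in (0 : ℝ)..t, r n s) +
      (G : 𝕜) * ∫ s in (0 : ℝ)..t, p n s) := by
    intro n
    have cp := hcont (hp n)
    have cr := hcont (hr n)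
    rw [map_sub, hU, ← (h0 n).2.1,
      ← intervalIntegral.integral_eq_sub_of_hasDerivAt (fun s _ => hu n s) (ii (by fun_prop)),
      intervalIntegral.integral_const_mul,
      intervalIntegral.integral_add (ii (by fun_prop)) (ii (by fun_prop))]
    simp only [intervalIntegral.integral_const_mul]
  have er : ∀ n, cosC n (R t - R₀) = -(ν : 𝕜) * (∫ s in (0 : ℝ)..t, r n s) +
      (E : 𝕜) * ((n : 𝕜) * ∫ s in (0 : ℝ)..t, u n s) + ∫ s in (0 : ℝ)..t, f n s := by
    intro n
    have cu := hcont (hu n)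
    have cr := hcont (hr n)
    have cf := hfc n
    rw [map_sub, hR, ← (h0 n).2.2,
      ← intervalIntegral.integral_eq_sub_of_hasDerivAt (fun s _ => hr n s) (ii (by fun_prop)),
      intervalIntegral.integral_add (ii (by fun_prop)) (ii (by fun_prop)),
      intervalIntegral.integral_add (ii (by fun_prop)) (ii (by fun_prop))]
    simp only [intervalIntegral.integral_const_mul]
  have hαk : (α : 𝕜) ≠ 0 := by exact_mod_cast hα
  -- The bounds on u do not control n ∫ u. The integrated first equation does: since α ≠ 0, it
  -- exhibits the derivative of ∫ U as an element of L².
  set dU : L2 𝕜 := α⁻¹ • (P t - P₀ + lam • ∫ s in (0 : ℝ)..t, P s) with hdU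
  have edU : ∀ n, cosC n dU = (n : 𝕜) * sinC n (∫ s in (0 : ℝ)..t, U s) := by
    intro n
    rw [hdU, map_smul, map_add, map_smul, ep, iP, iU]
    simp only [RCLike.real_smul_eq_coe_mul]
    push_cast
    field_simp; ring
  refine ⟨dU, hasWeakDeriv_of_cosC edU, vanishesAtEnds_of_cosC edU,
    hasWeakDeriv_of_sinC fun n => ?_, ?_, cosC_ext fun n => ?_⟩
  · rw [eu, map_neg, map_add, map_smul, map_smul, iR, iP]
    simp only [RCLike.real_smul_eq_coe_mul]
    ring
  · rw [hdU, smul_inv_smul₀ hα, neg_smul]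
    abel
  · rw [map_sub, er, iF, map_add, map_smul, map_smul, edU, iR, iU]
    simp only [RCLike.real_smul_eq_coe_mul]
    push_cast
    ring

/-! ### Uniqueness of solutions. -/

/-- The linear Volterra equation `d = L ∫ d` has only the trivial solution. -/
theorem eqOn_zero_of_eq_integral {H : Type*} [NormedAddCommGroup H] [NormedSpace ℝ H]
    [CompleteSpace H] (L : H →L[ℝ] H) {T : ℝ} (hT : 0 < T) {d : ℝ → H}
    (hd : ContinuousOn d (Icc 0 T)) (h : ∀ t ∈ Icc 0 T, d t = L (∫ s in (0 : ℝ)..t, d s)) :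
    ∀ t ∈ Icc 0 T, d t = 0 := by
  set d' : ℝ → H := IccExtend hT.le ((Icc 0 T).domRestrict d) with hd'
  have hc : Continuous d' := hd.domRestrict.Icc_extend'
  have heq : ∀ t ∈ Icc 0 T, d' t = d t := fun t ht => IccExtend_of_mem hT.le _ ht
  have hint : ∀ t ∈ Icc 0 T, ∫ s in (0 : ℝ)..t, d' s = ∫ s in (0 : ℝ)..t, d s := by
    intro t ht
    refine intervalIntegral.integral_congr fun s hs => heq s ?_
    rw [uIcc_of_le ht.1] at hs
    exact ⟨hs.1, hs.2.trans ht.2⟩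
  have hderiv : ∀ t, HasDerivAt (fun t => ∫ s in (0 : ℝ)..t, d' s) (d' t) t :=
    fun t => (hc.integral_hasStrictDerivAt 0 t).hasDerivAt
  -- The primitive y of the extended d solves y' = L y on [0,T) with y(0) = 0.
  have hzero : EqOn (fun t => ∫ s in (0 : ℝ)..t, d' s) (fun _ => 0) (Icc 0 T) := by
    refine ODE_solution_unique (v := fun _ => L) (fun _ => L.lipschitz)
      (fun t _ => (hderiv t).continuousAt.continuousWithinAt) (fun t ht => ?_)
      continuousOn_const (fun t _ => ?_) (by simp)
    · have ht' := Ico_subset_Icc_self ht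
      have : d' t = L (∫ s in (0 : ℝ)..t, d' s) := by rw [heq t ht', hint t ht', ← h t ht']
      rw [← this]
      exact (hderiv t).hasDerivWithinAt
    · rw [map_zero]
      exact hasDerivWithinAt_const _ _ _
  intro t ht
  rw [h t ht, ← hint t ht, show ∫ s in (0 : ℝ)..t, d' s = 0 from hzero ht, map_zero]

/-- The coefficients of a state. -/
noncomputable def stateC (n : ℕ) : State 𝕜 →L[ℝ] 𝕜 × 𝕜 × 𝕜 :=
  (cosC n).prodMap ((sinC n).prodMap (cosC n))

theorem stateC_apply (n : ℕ) (z : State 𝕜) :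
    stateC n z = (cosC n z.1, sinC n z.2.1, cosC n z.2.2) := rfl

/-- On the coefficients of frequency n, A is a 3×3 matrix. The boundary condition on u enters
through `HasWeakDeriv.cosC_eq`. -/
theorem IsOpA.exists_stateC (𝕜 : Type*) [RCLike 𝕜] (a γ ρs μ κ : ℝ) (n : ℕ) :
    ∃ L : 𝕜 × 𝕜 × 𝕜 →L[ℝ] 𝕜 × 𝕜 × 𝕜, ∀ z w : State 𝕜, IsOpA a γ ρs μ κ z w →
      stateC n w = L (stateC n z) := by
  let c1 : 𝕜 × 𝕜 × 𝕜 →L[ℝ] 𝕜 := ContinuousLinearMap.fst ℝ 𝕜 (𝕜 × 𝕜)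
  let c2 : 𝕜 × 𝕜 × 𝕜 →L[ℝ] 𝕜 :=
    (ContinuousLinearMap.fst ℝ 𝕜 𝕜).comp (ContinuousLinearMap.snd ℝ 𝕜 (𝕜 × 𝕜))
  let c3 : 𝕜 × 𝕜 × 𝕜 →L[ℝ] 𝕜 :=
    (ContinuousLinearMap.snd ℝ 𝕜 𝕜).comp (ContinuousLinearMap.snd ℝ 𝕜 (𝕜 × 𝕜))
  refine ⟨((-ρs * n) • c2).prod
    ((-((n : ℝ) • (-(a * γ * ρs ^ (γ - 2)) • c1 + (1 / ρs) • c3))).prod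
      ((μ / κ * n) • c2 - (1 / κ) • c3)), fun z w => ?_⟩
  rintro ⟨du, dq, hdu, hv, hdq, rfl⟩
  have e1 := hdu.cosC_eq hv n
  have e2 := hdq.sinC_eq n
  have hn : ∀ x : 𝕜, (n : 𝕜) * x = (n : ℝ) • x := fun x => by
    rw [RCLike.real_smul_eq_coe_mul, RCLike.ofReal_natCast]
  rw [hn] at e1 e2
  rw [map_add, map_smul, map_smul] at e2
  rw [stateC_apply, stateC_apply]
  simp only [map_sub, map_smul]
  rw [e1, e2]
  simp [c1, c2, c3, smul_smul]

/-- Each coefficient triple of the difference satisfies d = L ∫ d in finite dimension, hence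
vanishes, and the coefficients determine the state. -/
theorem IsSolution.eqOn {a γ ρs μ κ T : ℝ} (hT : 0 < T) {z₀ : State 𝕜} {F z z' : ℝ → State 𝕜}
    (h' : IsSolution a γ ρs μ κ T z₀ F z') (h : IsSolution a γ ρs μ κ T z₀ F z) :
    EqOn z' z (Icc 0 T) := by
  have key : ∀ n, ∀ t ∈ Icc 0 T, stateC n (z' t - z t) = 0 := by
    intro n
    obtain ⟨L, hL⟩ := IsOpA.exists_stateC 𝕜 a γ ρs μ κ n
    refine eqOn_zero_of_eq_integral L hT ((stateC n).continuous.comp_continuousOn (h'.1.sub h.1))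
      fun t ht => ?_
    have hsub : uIcc 0 t ⊆ Icc 0 T := by
      rw [uIcc_of_le ht.1]
      exact Icc_subset_Icc_right ht.2
    have i' := (h'.1.mono hsub).intervalIntegrable (μ := volume)
    have i := (h.1.mono hsub).intervalIntegrable (μ := volume)
    have e' := hL _ _ (h'.2 t ht)
    have e := hL _ _ (h.2 t ht)
    rw [ContinuousLinearMap.intervalIntegral_comp_comm _ (i'.sub i),
      intervalIntegral.integral_sub i' i, map_sub (stateC n) (∫ s in (0 : ℝ)..t, z' s), map_sub L,
      ← e, ← e', ← map_sub]
    congr 1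
    abel
  intro t ht
  have hc := fun n => key n t ht
  simp only [stateC_apply, Prod.mk_eq_zero] at hc
  rw [← sub_eq_zero]
  refine Prod.ext (cosC_ext fun n => ?_) (Prod.ext (sinC_ext fun n => ?_) (cosC_ext fun n => ?_))
  · rw [(hc n).1]; exact (map_zero _).symm
  · rw [(hc n).2.1]; exact (map_zero _).symm
  · rw [(hc n).2.2]; exact (map_zero _).symm

theorem integral_state {x y w : ℝ → L2 𝕜} (hx : Continuous x) (hy : Continuous y)
    (hw : Continuous w) (t : ℝ) :
    ∫ s in (0 : ℝ)..t, ((x s, y s, w s) : State 𝕜) =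
      (∫ s in (0 : ℝ)..t, x s, ∫ s in (0 : ℝ)..t, y s, ∫ s in (0 : ℝ)..t, w s) := by
  have hi : IntervalIntegrable (fun s => ((x s, y s, w s) : State 𝕜)) volume 0 t :=
    (hx.prodMk (hy.prodMk hw)).intervalIntegrable _ _
  refine Prod.ext ?_ (Prod.ext ?_ ?_)
  · exact (ContinuousLinearMap.intervalIntegral_comp_comm
      (ContinuousLinearMap.fst ℝ (L2 𝕜) (L2 𝕜 × L2 𝕜)) hi).symm
  · exact (ContinuousLinearMap.intervalIntegral_comp_comm
      ((ContinuousLinearMap.fst ℝ (L2 𝕜) (L2 𝕜)).comp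
        (ContinuousLinearMap.snd ℝ (L2 𝕜) (L2 𝕜 × L2 𝕜))) hi).symm
  · exact (ContinuousLinearMap.intervalIntegral_comp_comm
      ((ContinuousLinearMap.snd ℝ (L2 𝕜) (L2 𝕜)).comp
        (ContinuousLinearMap.snd ℝ (L2 𝕜) (L2 𝕜 × L2 𝕜))) hi).symm

theorem isControl_of_continuous {f : ℝ → L2 𝕜} (hf : Continuous f) (T : ℝ) : IsControl T f := by
  obtain ⟨C, hC⟩ := (isCompact_Icc (a := (0 : ℝ)) (b := T)).exists_bound_of_continuousOn
    hf.continuousOn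
  refine MemLp.of_bound hf.aestronglyMeasurable C ?_
  filter_upwards [ae_restrict_mem measurableSet_Ioo] with t ht
  exact hC t (Ioo_subset_Icc_self ht)

end Solutions

end MaxwellCNS

/-! ### Density control and stress control as instances of the mode system. -/

theorem theorem1p3 {𝕜 : Type*} [RCLike 𝕜] (a γ ρs μ κ : ℝ)
    (ha : 0 < a) (hγ : 1 ≤ γ) (hρs : 0 < ρs) (hμ : 0 < μ) (hκ : 0 < κ)
    (T : ℝ) (hT : 0 < T) :
    (∀ z₀ : MaxwellCNS.State 𝕜, z₀.2.2 ∈ MaxwellCNS.L2m 𝕜 →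
      ∃ f₁ : ℝ → MaxwellCNS.L2 𝕜, MaxwellCNS.IsControl T f₁ ∧
        ∃ z : ℝ → MaxwellCNS.State 𝕜,
          MaxwellCNS.IsSolution a γ ρs μ κ T z₀ (fun t => (f₁ t, 0, 0)) z ∧
          (∀ z' : ℝ → MaxwellCNS.State 𝕜,
            MaxwellCNS.IsSolution a γ ρs μ κ T z₀ (fun t => (f₁ t, 0, 0)) z' →
              Set.EqOn z' z (Set.Icc 0 T)) ∧
          (∀ t ∈ Set.Icc 0 T, (z t).2.2 ∈ MaxwellCNS.L2m 𝕜) ∧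
          z T = 0) ∧
    (∀ z₀ : MaxwellCNS.State 𝕜, z₀.1 ∈ MaxwellCNS.L2m 𝕜 →
      ∃ f₃ : ℝ → MaxwellCNS.L2 𝕜, MaxwellCNS.IsControl T f₃ ∧
        ∃ z : ℝ → MaxwellCNS.State 𝕜,
          MaxwellCNS.IsSolution a γ ρs μ κ T z₀ (fun t => (0, 0, f₃ t)) z ∧
          (∀ z' : ℝ → MaxwellCNS.State 𝕜,
            MaxwellCNS.IsSolution a γ ρs μ κ T z₀ (fun t => (0, 0, f₃ t)) z' →
              Set.EqOn z' z (Set.Icc 0 T)) ∧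
          (∀ t ∈ Set.Icc 0 T, (z t).1 ∈ MaxwellCNS.L2m 𝕜) ∧
          z T = 0) := by

  have hb : 0 < a * γ * ρs ^ (γ - 2) := by
    have : 0 < γ := by linarith
    have := Real.rpow_pos_of_pos hρs (γ - 2)
    positivity
  refine ⟨fun z₀ hz₀ => ?_, fun z₀ hz₀ => ?_⟩
  -- The density is controlled, so the stress is the flat output. Differentiating cosines flips the
  -- sign of -bρ + S/ρs, which gives β = b and G = -1/ρs; w² = bρs + μ/(κρs).
  · obtain ⟨S, u, ρ, f, hSc, huc, hρc, hfc, ⟨hST, huT, hρT⟩, hm, H⟩ :=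
      MaxwellCNS.exists_null_control (lam := 1 / κ) (α := μ / κ) (β := a * γ * ρs ^ (γ - 2))
        (G := -(1 / ρs)) (ν := 0) (E := -ρs) (by positivity) hb.ne' (by
          have : 0 < μ / κ * (1 / ρs) := by positivity
          nlinarith [mul_pos hb hρs]) hT z₀.2.2 z₀.2.1 z₀.1 hz₀
    have hsol : MaxwellCNS.IsSolution a γ ρs μ κ T z₀ (fun t => (f t, 0, 0))
        (fun t => (ρ t, u t, S t)) := by
      refine ⟨(hρc.prodMk (huc.prodMk hSc)).continuousOn, fun t _ => ?_⟩
      obtain ⟨du, hdu, hv, hdq, eS, eρ⟩ := H t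
      rw [MaxwellCNS.integral_state hρc huc hSc,
        MaxwellCNS.integral_state hfc continuous_const continuous_const,
        intervalIntegral.integral_zero]
      refine ⟨du, _, hdu, hv, ?_, Prod.ext ?_ (Prod.ext (sub_zero _) ?_)⟩
      · convert hdq using 1
        module
      · refine eρ.trans ?_
        rw [neg_zero, zero_smul, zero_add]
      · refine (sub_zero _).trans (eS.trans ?_)
        module
    refine ⟨f, MaxwellCNS.isControl_of_continuous hfc T, _, hsol, fun z' h' => h'.eqOn hT hsol,
      fun t _ => hm t, ?_⟩
    simp only [hST, huT, hρT]
    rfl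
  -- The roles of density and stress are exchanged; w² is the same.
  · obtain ⟨ρ, u, S, f, hρc, huc, hSc, hfc, ⟨hρT, huT, hST⟩, hm, H⟩ :=
      MaxwellCNS.exists_null_control (lam := 0) (α := -ρs) (β := -(1 / ρs))
        (G := a * γ * ρs ^ (γ - 2)) (ν := 1 / κ) (E := μ / κ) (neg_ne_zero.2 hρs.ne')
        (neg_ne_zero.2 (by positivity)) (by
          have : 0 < μ / κ * (1 / ρs) := by positivity
          nlinarith [mul_pos hb hρs]) hT z₀.1 z₀.2.1 z₀.2.2 hz₀
    have hsol : MaxwellCNS.IsSolution a γ ρs μ κ T z₀ (fun t => (0, 0, f t))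
        (fun t => (ρ t, u t, S t)) := by
      refine ⟨(hρc.prodMk (huc.prodMk hSc)).continuousOn, fun t _ => ?_⟩
      obtain ⟨du, hdu, hv, hdq, eρ, eS⟩ := H t
      rw [MaxwellCNS.integral_state hρc huc hSc,
        MaxwellCNS.integral_state continuous_const continuous_const hfc,
        intervalIntegral.integral_zero]
      refine ⟨du, _, hdu, hv, ?_, Prod.ext ?_ (Prod.ext (sub_zero _) ?_)⟩
      · convert hdq using 1
        module
      · refine (sub_zero _).trans (eρ.trans ?_)
        rw [neg_zero, zero_smul, zero_add]
      · refine eS.trans ?_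
        module
    refine ⟨f, MaxwellCNS.isControl_of_continuous hfc T, _, hsol, fun z' h' => h'.eqOn hT hsol,
      fun t _ => hm t, ?_⟩
    simp only [hST, huT, hρT]
    rfl
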